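/- Let $m,k\ge 1$ and $T>0$. Write $M_{2m}(\mathbb R)$ for the real $2m\times 2m$ matrices, with norm $|P|=\operatorname{tr}(P^*P)^{1/2}$ and bracket $[P,Q]=PQ-QP$, let $\mathbb J=\begin{pmatrix}0&I_m\\-I_m&0\end{pmatrix}$, let $\mathrm{Sp}(m)=\{X\in M_{2m}(\mathbb R): X^*\mathbb JX=\mathbb J\}$, and let $T_{I}\mathrm{Sp}(m)=\{Y\in M_{2m}(\mathbb R): \mathbb JY \text{ is symmetric}\}$ be its tangent space at the identity. Let $t\in[0,T]\mapsto A(t)\in M_{2m}(\mathbb R)$ be smooth and let $B_1,\dots,B_k\in M_{2m}(\mathbb R)$ be such that $A(t)\in T_I\mathrm{Sp}(m)$ for all $t\in[0,T]$, $B_i\in T_I\mathrm{Sp}(m)$ for all $i$, and $$B_iB_j=0\qquad\text{for all } i,j=1,\dots,k.$$ Define smooth maps $B_i^j$ on $[0,T]$ by $B_i^0(t)=B_i$ and $B_i^{j}(t)=\dot B_i^{j-1}(t)+B_i^{j-1}(t)A(t)-A(t)B_i^{j-1}(t)$ for $j\ge1$. Assume that $$[B_i^j(0),B_i]\in\operatorname{Span}\{B_r^s(0):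 r=1,\dots,k,\ s\ge0\}\qquad\text{for all } i=1,\dots,k,\ j=1,2,$$ $$\operatorname{Span}\{B_i^j(0),\,[B_i^1(0),B_l^1(0)] : i,l=1,\dots,k,\ j=0,1,2\}=T_I\mathrm{Sp}(m).$$ Then for every $\bar X\in\mathrm{Sp}(m)$ the control system $$\dot X(t)=A(t)X(t)+\sum_{i=1}^k u_i(t)B_iX(t)\quad\text{for a.e. } t\in[0,T],\qquad X(0)=\bar X,$$ is controllable at second order around $\bar u\equiv0$ in $\mathrm{Sp}(m)$: if $\bar X(\cdot)$ denotes its solution for $u\equiv0$, there are $\mu,K>0$ such that for every $X\in\mathrm{Sp}(m)$ with $|X-\bar X(T)|<\mu$ there is a control $u\in L^2([0,T];\mathbb R^k)$ whose solution starting from $\bar X$ has end point $X$ at time $T$ and which satisfies $$\|u\|_{L^2}\le K\,|X-\bar X(T)|^{1/2}.$$ -/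

import Mathlib

open MeasureTheory Set
open scoped ContDiff Matrix.Norms.Frobenius

namespace SympControl

/-- The space `M_{2m}(ℝ)` of real matrices of size `2m`, written in `m × m` blocks; it carries the
Frobenius norm, that is the norm of the scalar product `tr (Pᵀ Q)`. -/
abbrev Mat (m : ℕ) : Type := Matrix (Fin m ⊕ Fin m) (Fin m ⊕ Fin m) ℝ

/-- The symplectic group `Sp(m)`, as a set of matrices of size `2m`. -/
def Sp (m : ℕ) : Set (Mat m) := (Matrix.symplecticGroup (Fin m) ℝ : Set (Mat m))

/-- The tangent space of `Sp(m)` at the identity (the Lie algebra of `Sp(m)`):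
the matrices `Y` such that `J Y` is symmetric. -/
def spTangent (m : ℕ) : Submodule ℝ (Mat m) where
  carrier := {Y | (Matrix.J (Fin m) ℝ * Y).IsSymm}
  add_mem' {a b} ha hb := by
    simp only [mem_ofPred_eq, mul_add] at *
    exact ha.add hb
  zero_mem' := by simp
  smul_mem' c a ha := by
    simp only [mem_ofPred_eq, Matrix.mul_smul] at *
    exact ha.smul c

/-- The space of controls `L²([0,T]; ℝᵏ)` with its `L²` norm. -/
abbrev Control (k : ℕ) (T : ℝ) : Type :=
  Lp (EuclideanSpace ℝ (Fin k)) 2 (volume.restrict (Icc (0 : ℝ) T))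

/-- `X` is the solution on `[0,T]` of the Cauchy problem
`X'(t) = A(t) X(t) + ∑ i, u_i(t) B_i X(t)` for almost every `t ∈ [0,T]`, `X(0) = X₀`:
an absolutely continuous curve that satisfies the equation almost everywhere. -/
structure IsSolution {m k : ℕ} (T : ℝ) (A : ℝ → Mat m) (B : Fin k → Mat m)
    (u : Control k T) (X₀ : Mat m) (X : ℝ → Mat m) : Prop where
  absCont : AbsolutelyContinuousOnInterval X 0 T
  initial : X 0 = X₀
  ode : ∀ᵐ t ∂(volume.restrict (Icc (0 : ℝ) T)),
    HasDerivAt X (A t * X t + ∑ i, u t i • (B i * X t)) t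

/-- The sequence `B_i^j` attached to a matrix `B_i` and the curve `A` on `[0,T]`:
`B_i^0 = B_i` and `B_i^{j+1} = (B_i^j)' + B_i^j A - A B_i^j`, the derivative being taken in
`[0,T]` (one-sided at the end points). -/
noncomputable def bracketSeq {m : ℕ} (T : ℝ) (A : ℝ → Mat m) (Bi : Mat m) : ℕ → ℝ → Mat m
  | 0 => fun _ => Bi
  | j + 1 => fun t =>
      derivWithin (bracketSeq T A Bi j) (Icc 0 T) t
        + bracketSeq T A Bi j t * A t - A t * bracketSeq T A Bi j t

/-- The control system with drift `A` and matrices `B_i` is controllable at second order in `Sp(m)`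
around the control `ubar`, from the initial state `X₀`, in time `T`. Here `Xbar` is the trajectory
of `ubar` from `X₀`, and `Z T = X` says that the end point of the trajectory of `u` is `X`. -/
def ControllableAtSecondOrder {m k : ℕ} (T : ℝ) (A : ℝ → Mat m) (B : Fin k → Mat m)
    (ubar : Control k T) (X₀ : Mat m) : Prop :=
  ∃ Xbar : ℝ → Mat m, IsSolution T A B ubar X₀ Xbar ∧
    ∃ μ K : ℝ, 0 < μ ∧ 0 < K ∧
      ∀ X ∈ Metric.ball (Xbar T) μ ∩ Sp m,
        ∃ u : Control k T,
          (∃ Z : ℝ → Mat m, IsSolution T A B u X₀ Z ∧ Z T = X) ∧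
            ‖u‖ ≤ K * ‖X - Xbar T‖ ^ (1 / 2 : ℝ)

end SympControl

/-! Let S be the fundamental solution of the drift. Every trajectory is X = S W X₀ with W' = (∑ u_i
C_i) W, W(0) = 1 and C_i = S⁻¹ B_i S, and the j-th derivative of C_i at 0 is B_i^j(0). It is
therefore enough to steer W(T) near 1. This is done after applying the linear projection `spProj`
onto the Lie algebra, which is injective on Sp(m) near 1 (`eq_of_spProj_sub_one_eq`). There the end
point expands as a linear term in u, plus the quadratic term ∫ M(t) ∫₀ᵗ M(s) ds dt with M = ∑ u_i
C_i, plus a cubic remainder.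

The range V of the linear term contains every B_i^j(0), since a functional vanishing on V vanishes
along all the C_i, hence on their derivatives. Modulo V the Lie algebra is spanned by the brackets
[B_i^1, B_l^1], which must come from the quadratic term on the kernel of the linear one. For each
ordered pair (i,l), take a control with two profiles on a time scale η. The profiles are fourth
derivatives of bump-like functions, so the linear term is o(η⁴) and a small correction puts the
control in the kernel. In the quadratic term, the derivatives at 0 of C_i C_j = 0 and the bracket
hypotheses remove all contributions up to order η⁴ modulo V, except c η⁴ [B_i^1, B_l^1] with c > 0
(`exists_profiles`, `tendsto_iterInt_pairCurve_self`).

Pairs placed in disjoint windows do not interact at this order, so the quadratic form tends, after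
division by η⁴, to ∑ α_p² e_p, where e_p is antisymmetric in the pair p. Hence ∑ e_p = 0, so α =
(1,…,1) is a zero. It is a regular one because the e_p span the quotient, and it persists for small
η (`eventually_exists_regular_zero`, `exists_regular_control`).

A regular zero gives the square root estimate (`exists_second_order_preimage`). For u = ε(v + εz)
with v in the kernel of the linear term, the displacement of the end point divided by ε² is C¹ in
(ε, z, v) and submersive in (z, v) at ε = 0, so one takes ε of the order of the square root of the
distance to the target. -/

namespace SympControl
open intervalIntegral

/-! ### Linear differential equations through Volterra operators. -/

section Volterra
variable {E : Type*} [NormedAddCommGroup E] {T : ℝ}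

/-- The value at `t` of the continuous extension of a continuous function on `[0,T]`. -/
noncomputable def extend (hT : 0 ≤ T) (Y : C(Icc (0 : ℝ) T, E)) : ℝ → E := IccExtend hT Y

lemma continuous_extend (hT : 0 ≤ T) (Y : C(Icc (0 : ℝ) T, E)) : Continuous (extend hT Y) :=
  Y.continuous.Icc_extend'

lemma extend_of_mem (hT : 0 ≤ T) (Y : C(Icc (0 : ℝ) T, E)) {t : ℝ} (ht : t ∈ Icc 0 T) :
    extend hT Y t = Y ⟨t, ht⟩ := IccExtend_of_mem hT Y ht

lemma norm_extend_le (hT : 0 ≤ T) (Y : C(Icc (0 : ℝ) T, E)) (t : ℝ) : ‖extend hT Y t‖ ≤ ‖Y‖ :=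
  Y.norm_coe_le_norm _

variable [NormedSpace ℝ E] [CompleteSpace E]

/-- The integration operator `Y ↦ (t ↦ ∫₀ᵗ Y)` on continuous functions on `[0,T]`. -/
noncomputable def primitive (E : Type*) [NormedAddCommGroup E] [NormedSpace ℝ E] [CompleteSpace E]
    {T : ℝ} (hT : 0 ≤ T) : C(Icc (0 : ℝ) T, E) →L[ℝ] C(Icc (0 : ℝ) T, E) :=
  LinearMap.mkContinuous
    { toFun := fun Y => ⟨fun t => ∫ s in (0 : ℝ)..t, extend hT Y s,
        (continuous_primitive (fun a b => (continuous_extend hT Y).intervalIntegrable a b) 0).comp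
          continuous_subtype_val⟩
      map_add' := fun Y Z => by
        ext t
        exact integral_add ((continuous_extend hT Y).intervalIntegrable _ _)
          ((continuous_extend hT Z).intervalIntegrable _ _)
      map_smul' := fun c Y => by
        ext t
        exact integral_smul c (extend hT Y) }
    T (fun Y => by
      refine (ContinuousMap.norm_le _ (by positivity)).2 fun t => ?_
      refine (norm_integral_le_of_norm_le_const (C := ‖Y‖) fun s _ =>
        norm_extend_le hT Y s).trans ?_
      rw [sub_zero, abs_of_nonneg t.2.1, mul_comm]
      exact mul_le_mul_of_nonneg_right t.2.2 (norm_nonneg _))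

end Volterra

/-- Factor 1 - xⁿ = (1 - x)(1 + x + ⋯ + xⁿ⁻¹). This serves the Volterra operator, which need not be
a contraction although some power of it is. -/
lemma exists_one_sub_mul_eq_one {R : Type*} [NormedRing R] [CompleteSpace R] {x : R} {n : ℕ}
    (hx : ‖x ^ n‖ < 1) : ∃ y, (1 - x) * y = 1 :=
  ⟨(∑ i ∈ Finset.range n, x ^ i) * ↑(Units.oneSub (x ^ n) hx)⁻¹, by
    rw [← mul_assoc, mul_neg_geom_sum]
    exact (Units.oneSub (x ^ n) hx).mul_inv⟩

section LinearODE
variable {𝔸 : Type*} [NormedRing 𝔸] [NormedAlgebra ℝ 𝔸] [CompleteSpace 𝔸] {T : ℝ}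

/-- The Volterra operator `Y ↦ (t ↦ ∫₀ᵗ M Y)`. -/
noncomputable def volterra (hT : 0 ≤ T) :
    C(Icc (0 : ℝ) T, 𝔸) →L[ℝ] C(Icc (0 : ℝ) T, 𝔸) →L[ℝ] C(Icc (0 : ℝ) T, 𝔸) :=
  (ContinuousLinearMap.compL ℝ _ _ _ (primitive 𝔸 hT)).comp (ContinuousLinearMap.mul ℝ _)

lemma volterra_apply (hT : 0 ≤ T) (M Y : C(Icc (0 : ℝ) T, 𝔸)) (t : Icc (0 : ℝ) T) :
    volterra hT M Y t = ∫ s in (0 : ℝ)..t, extend hT M s * extend hT Y s := rfl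

/-- A fixed point of `Y ↦ 1 + ∫ M Y` solves the linear equation `Y' = M Y`. -/
lemma exists_hasDerivAt_of_fixed (hT : 0 ≤ T) (M W : C(Icc (0 : ℝ) T, 𝔸))
    (hW : W = 1 + volterra hT M W) :
    ∃ S : ℝ → 𝔸, S 0 = 1 ∧ (∀ t ∈ Icc 0 T, HasDerivAt S (extend hT M t * S t) t) ∧
      ∀ t (ht : t ∈ Icc 0 T), S t = W ⟨t, ht⟩ := by
  have hc : Continuous fun s => extend hT M s * extend hT W s :=
    (continuous_extend hT M).mul (continuous_extend hT W)
  have key : ∀ t (ht : t ∈ Icc 0 T),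
      1 + ∫ s in (0 : ℝ)..t, extend hT M s * extend hT W s = W ⟨t, ht⟩ := fun t ht => by
    conv_rhs => rw [hW]
    rfl
  -- The integrand is continuous on the whole line, being constant beyond the end points, so the
  -- derivative is two-sided even at 0 and T.
  refine ⟨fun t => 1 + ∫ s in (0 : ℝ)..t, extend hT M s * extend hT W s, by simp,
    fun t ht => ?_, key⟩
  beta_reduce
  rw [key t ht, ← extend_of_mem hT W ht]
  exact (hc.integral_hasStrictDerivAt 0 t).hasDerivAt.const_add 1

lemma norm_volterra_pow_apply_le (hT : 0 ≤ T) (M Y : C(Icc (0 : ℝ) T, 𝔸)) (n : ℕ)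
    (t : Icc (0 : ℝ) T) :
    ‖(volterra hT M ^ n) Y t‖ ≤ (‖M‖ * t) ^ n / n.factorial * ‖Y‖ := by
  induction n generalizing t with
  | zero => simpa using Y.norm_coe_le_norm t
  | succ n ih =>
    rw [pow_succ', mul_apply_eq_comp, volterra_apply]
    have hle : ∀ s ∈ Ioc (0 : ℝ) t, ‖extend hT M s * extend hT ((volterra hT M ^ n) Y) s‖ ≤
        ‖M‖ * ((‖M‖ * s) ^ n / n.factorial * ‖Y‖) := fun s hs => by
      have hs' : s ∈ Icc 0 T := ⟨hs.1.le, hs.2.trans t.2.2⟩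
      refine (norm_mul_le _ _).trans ?_
      refine mul_le_mul (norm_extend_le _ _ _) ?_ (norm_nonneg _) (norm_nonneg _)
      rw [extend_of_mem _ _ hs']
      exact ih ⟨s, hs'⟩
    refine (norm_integral_le_of_norm_le t.2.1 (.of_forall hle)
      (Continuous.intervalIntegrable (by fun_prop) _ _)).trans_eq ?_
    have : (fun s : ℝ => ‖M‖ * ((‖M‖ * s) ^ n / n.factorial * ‖Y‖)) =
        fun s => (‖M‖ ^ (n + 1) / n.factorial * ‖Y‖) * s ^ n := by
      ext s; ring
    rw [this, intervalIntegral.integral_const_mul, integral_pow, Nat.factorial_succ]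
    push_cast
    field_simp
    ring

/-- Global existence for linear equations with continuous coefficients. -/
lemma exists_volterra_fixed (hT : 0 ≤ T) (M : C(Icc (0 : ℝ) T, 𝔸)) :
    ∃ W, W = 1 + volterra hT M W := by
  set K := volterra hT M
  have hlim := (FloorSemiring.tendsto_pow_div_factorial_atTop (‖M‖ * T))
  obtain ⟨n, hn⟩ := (hlim.eventually (gt_mem_nhds (show (0 : ℝ) < 1 by norm_num))).exists
  have hK : ‖K ^ n‖ < 1 := by
    refine (ContinuousLinearMap.opNorm_le_bound _ (by positivity) fun Y => ?_).trans_lt hn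
    refine (ContinuousMap.norm_le _ (by positivity)).2 fun t => ?_
    refine (norm_volterra_pow_apply_le hT M Y n t).trans ?_
    have := t.2.1
    have := t.2.2
    gcongr
  obtain ⟨V, hV⟩ := exists_one_sub_mul_eq_one (R := C(Icc (0 : ℝ) T, 𝔸) →L[ℝ] C(Icc (0 : ℝ) T, 𝔸)) hK
  refine ⟨V 1, ?_⟩
  have h1 : V 1 - K (V 1) = 1 := DFunLike.congr_fun hV (1 : C(Icc (0 : ℝ) T, 𝔸))
  exact eq_add_of_sub_eq h1

lemma exists_linear_ode (hT : 0 ≤ T) {a : ℝ → 𝔸} (ha : ContinuousOn a (Icc 0 T)) :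
    ∃ S : ℝ → 𝔸, S 0 = 1 ∧ ∀ t ∈ Icc 0 T, HasDerivAt S (a t * S t) t := by
  obtain ⟨W, hW⟩ := exists_volterra_fixed hT ⟨_, ha.domRestrict⟩
  obtain ⟨S, h0, hS, -⟩ := exists_hasDerivAt_of_fixed hT _ W hW
  refine ⟨S, h0, fun t ht => ?_⟩
  have := hS t ht
  rwa [extend_of_mem hT _ ht] at this

end LinearODE

lemma absolutelyContinuous_of_hasDerivAt {E : Type*} [NormedAddCommGroup E] [NormedSpace ℝ E]
    {T : ℝ} (hT : 0 ≤ T) {X X' : ℝ → E} (h : ∀ t ∈ Icc 0 T, HasDerivAt X (X' t) t)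
    (hX' : ContinuousOn X' (Icc 0 T)) : AbsolutelyContinuousOnInterval X 0 T := by
  obtain ⟨C, hC⟩ := isCompact_Icc.exists_bound_of_continuousOn hX'
  have := (convex_Icc (0 : ℝ) T).lipschitzOnWith_of_nnnorm_hasDerivWithin_le (C := C.toNNReal)
    (fun t ht => (h t ht).hasDerivWithinAt) (fun t ht => by
      rw [← NNReal.coe_le_coe, coe_nnnorm]
      exact (hC t ht).trans (Real.le_coe_toNNReal C))
  exact LipschitzOnWith.absolutelyContinuousOnInterval (by rwa [uIcc_of_le hT])

end SympControl

/-! ### Local surjectivity: regular zeros of quadratic maps and second order inversion. -/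

namespace SympControl
open Filter Topology

/-- Parametric local surjectivity: a `C¹` map whose partial derivative in the second variable is
onto is locally open in that variable, uniformly in the first one. -/
lemma eventually_exists_eq_of_surj {P Q F : Type*} [NormedAddCommGroup P] [NormedSpace ℝ P]
    [CompleteSpace P] [NormedAddCommGroup Q] [NormedSpace ℝ Q] [CompleteSpace Q]
    [NormedAddCommGroup F] [NormedSpace ℝ F] [CompleteSpace F] {H : P × Q → F} {p₀ : P} {q₀ : Q}
    (hH : ContDiffAt ℝ 1 H (p₀, q₀))
    (hsurj : ∀ y, ∃ ν, HasDerivAt (fun t : ℝ => H (p₀, q₀ + t • ν)) y 0)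
    {N : Set (P × Q)} (hN : N ∈ 𝓝 (p₀, q₀)) :
    ∀ᶠ x in 𝓝 (p₀, H (p₀, q₀)), ∃ q, (x.1, q) ∈ N ∧ H (x.1, q) = x.2 := by
  have hs := hH.hasStrictFDerivAt (by norm_num)
  set H' := fderiv ℝ H (p₀, q₀)
  -- Keeping the parameter as an extra component turns surjectivity of the partial derivative into
  -- surjectivity of a full derivative, so the open mapping form of the inverse function theorem
  -- applies.
  have hG : HasStrictFDerivAt (fun x : P × Q => (x.1, H x))
      ((ContinuousLinearMap.fst ℝ P Q).prod H') (p₀, q₀) := hasStrictFDerivAt_fst.prodMk hs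
  have hr : ((ContinuousLinearMap.fst ℝ P Q).prod H').range = ⊤ := by
    rw [LinearMap.range_eq_top]
    rintro ⟨p, y⟩
    obtain ⟨ν, hν⟩ := hsurj (y - H' (p, 0))
    refine ⟨(p, ν), Prod.ext rfl ?_⟩
    have hline : HasDerivAt (fun t : ℝ => (p₀, q₀ + t • ν)) ((0 : P), ν) 0 := by
      have h2 : HasDerivAt (fun t : ℝ => q₀ + t • ν) ν 0 := by
        simpa using ((hasDerivAt_id (0 : ℝ)).smul_const ν).const_add q₀
      exact (hasDerivAt_const (0 : ℝ) p₀).prodMk h2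
    have hs' : HasFDerivAt H H' (p₀, q₀ + (0 : ℝ) • ν) := by simpa using hs.hasFDerivAt
    have h1 : H' (0, ν) = y - H' (p, 0) := (hs'.comp_hasDerivAt (0 : ℝ) hline).unique hν
    change H' (p, ν) = y
    have : ((p, ν) : P × Q) = (p, 0) + (0, ν) := by simp
    rw [this, map_add, h1]
    abel
  have hmap := hG.map_nhds_eq_of_surj hr
  have him : (fun x : P × Q => (x.1, H x)) '' N ∈ 𝓝 (p₀, H (p₀, q₀)) := by
    rw [← hmap]
    exact image_mem_map hN
  filter_upwards [him]
  rintro ⟨p, y⟩ ⟨⟨p', q⟩, hq, heq⟩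
  obtain ⟨rfl, rfl⟩ := Prod.ext_iff.1 heq
  exact ⟨q, hq, rfl⟩

/-- If R is a right inverse of f, then g ∘ R is close to the identity for g close to f, hence
invertible. -/
lemma eventually_surjective {E F : Type*} [NormedAddCommGroup E] [NormedSpace ℝ E]
    [NormedAddCommGroup F] [NormedSpace ℝ F] [FiniteDimensional ℝ F] {f : E →L[ℝ] F}
    (hf : Function.Surjective f) : ∀ᶠ g : E →L[ℝ] F in 𝓝 f, Function.Surjective g := by
  have : CompleteSpace F := FiniteDimensional.complete ℝ F
  obtain ⟨r, hr⟩ := LinearMap.exists_rightInverse_of_surjective (f : E →ₗ[ℝ] F)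
    (LinearMap.range_eq_top.2 hf)
  set R : F →L[ℝ] E := LinearMap.toContinuousLinearMap r
  have h1 : f.comp R = 1 := by
    ext x
    exact LinearMap.congr_fun hr x
  have hc : Tendsto (fun g : E →L[ℝ] F => g.comp R) (𝓝 f) (𝓝 1) := by
    rw [← h1]
    exact Continuous.tendsto (by fun_prop) f
  filter_upwards [hc.eventually (Units.isOpen.mem_nhds isUnit_one)] with g hg y
  obtain ⟨u, hu⟩ := hg
  refine ⟨R ((↑u⁻¹ : F →L[ℝ] F) y), ?_⟩
  have h2 : g.comp R * (↑u⁻¹ : F →L[ℝ] F) = 1 := by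
    rw [← hu]
    exact u.mul_inv
  exact DFunLike.congr_fun h2 y

/-- Quadratic maps close to `α ↦ ∑ αₚ² eₚ`, with `∑ eₚ = 0` and `eₚ` spanning, have a zero at
which they are submersive. -/
lemma eventually_exists_regular_zero {ι E X : Type*} [Fintype ι] [DecidableEq ι]
    [NormedAddCommGroup E] [NormedSpace ℝ E] [FiniteDimensional ℝ E] {l : Filter X}
    {β : X → ι → ι → E} {e : ι → E}
    (hβ : ∀ p q, Tendsto (fun x => β x p q) l (𝓝 (if p = q then e p else 0)))
    (hsum : ∑ p, e p = 0) (hspan : Submodule.span ℝ (range e) = ⊤) :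
    ∀ᶠ x in l, ∃ α : ι → ℝ, ∑ p, ∑ q, (α p * α q) • β x p q = 0 ∧
      ∀ y, ∃ ν : ι → ℝ, ∑ p, ∑ q, (α p * ν q + ν p * α q) • β x p q = y := by
  have : CompleteSpace E := FiniteDimensional.complete ℝ E
  set b₀ : ι → ι → E := fun p q => if p = q then e p else 0
  let H : (ι → ι → E) × (ι → ℝ) → E := fun x => ∑ p, ∑ q, (x.2 p * x.2 q) • x.1 p q
  let D : (ι → ι → E) × (ι → ℝ) → (ι → ℝ) →L[ℝ] E := fun x =>
    ∑ p, ∑ q, (x.2 p • (ContinuousLinearMap.proj q : (ι → ℝ) →L[ℝ] ℝ).smulRight (x.1 p q) +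
      x.2 q • (ContinuousLinearMap.proj p : (ι → ℝ) →L[ℝ] ℝ).smulRight (x.1 p q))
  have hDapp : ∀ x ν, D x ν = ∑ p, ∑ q, (x.2 p * ν q + ν p * x.2 q) • x.1 p q := fun x ν => by
    simp only [D, sum_apply, add_apply, FunLike.coe_smul, Pi.smul_apply, add_smul, mul_smul,
      ContinuousLinearMap.smulRight_apply, ContinuousLinearMap.proj_apply]
    simp only [smul_comm (ν _) (x.2 _)]
  have hDc : Continuous D := by fun_prop
  have hH : ContDiff ℝ 1 H := by fun_prop
  -- The regular zero of the limiting form is α = (1,…,1), where the derivative is ν ↦ 2 ∑ νₚ eₚ.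
  have hH0 : H (b₀, 1) = 0 := by simpa [H, b₀] using hsum
  have hderiv : ∀ x : (ι → ι → E) × (ι → ℝ), ∀ ν,
      HasDerivAt (fun t : ℝ => H (x.1, x.2 + t • ν)) (D x ν) 0 := fun x ν => by
    rw [hDapp]
    refine HasDerivAt.fun_sum fun p _ => HasDerivAt.fun_sum fun q _ => ?_
    have h1 : ∀ r, HasDerivAt (fun t : ℝ => (x.2 + t • ν) r) (ν r) 0 := fun r => by
      simpa using ((hasDerivAt_id (0 : ℝ)).mul_const (ν r)).const_add (x.2 r)
    simpa [add_comm] using ((h1 p).mul (h1 q)).smul_const (x.1 p q)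
  have hsurj : Function.Surjective (D (b₀, 1)) := by
    intro y
    obtain ⟨c, hc⟩ := (Submodule.mem_span_range_iff_exists_fun ℝ).1
      (hspan ▸ Submodule.mem_top : y ∈ Submodule.span ℝ (range e))
    refine ⟨fun p => c p / 2, ?_⟩
    rw [hDapp, ← hc]
    simp [b₀]
  have hN : {x | Function.Surjective (D x)} ∈ 𝓝 (b₀, (1 : ι → ℝ)) :=
    hDc.continuousAt.eventually (eventually_surjective hsurj)
  have hev := eventually_exists_eq_of_surj hH.contDiffAt
    (fun y => (hsurj y).imp fun ν hν => hν ▸ hderiv (b₀, 1) ν) hN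
  rw [hH0] at hev
  have hlim : Tendsto (fun x => (β x, (0 : E))) l (𝓝 (b₀, 0)) :=
    (tendsto_pi_nhds.2 fun p => tendsto_pi_nhds.2 fun q => hβ p q).prodMk_nhds tendsto_const_nhds
  filter_upwards [hlim.eventually hev] with x hx
  obtain ⟨α, h1, h2⟩ := hx
  exact ⟨α, h2, fun y => (h1 y).imp fun ν hν => by rw [← hν, hDapp]⟩

/-- Second order local surjectivity of `u ↦ φ ((1 - K u)⁻¹ e)` at `u = 0`, at a regular zero of
the second order expansion. -/
lemma exists_second_order_preimage {U Y F : Type*} [NormedAddCommGroup U] [NormedSpace ℝ U]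
    [CompleteSpace U] [NormedAddCommGroup Y] [NormedSpace ℝ Y] [CompleteSpace Y]
    [NormedAddCommGroup F] [NormedSpace ℝ F] [CompleteSpace F]
    (K : U →L[ℝ] Y →L[ℝ] Y) (e : Y) (φ : Y →L[ℝ] F) {w z₀ : U} (hw : φ (K w e) = 0)
    (hz₀ : φ (K z₀ e) + φ (K w (K w e)) = 0)
    (hsurj : ∀ y, ∃ z v, φ (K v e) = 0 ∧
      φ (K z e) + (φ (K w (K v e)) + φ (K v (K w e))) = y)
    {ρ : ℝ} (hρ : 0 < ρ) :
    ∃ r > 0, ∃ C > 0, ∀ ε : ℝ, |ε| < r → ∀ y, ‖y‖ < r → ∃ u W, ‖u‖ ≤ C * |ε| ∧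
      W = e + K u W ∧ ‖W - e‖ < ρ ∧ φ W = φ e + ε ^ 2 • y := by
  let L : U →L[ℝ] F := φ.comp (K.flip e)
  have hL : ∀ u, L u = φ (K u e) := fun u => rfl
  let V := LinearMap.ker (L : U →ₗ[ℝ] F)
  have : CompleteSpace V := L.isClosed_ker.completeSpace_coe
  -- The control is ε • x with x = v + ε z: the part v lies in the kernel of the linear term, so z
  -- enters the expansion at order ε², like the quadratic term in v.
  let x : ℝ × (U × V) → U := fun p => p.2.2 + p.1 • p.2.1
  let W : ℝ × (U × V) → Y := fun p => Ring.inverse (1 - p.1 • K (x p)) e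
  -- This is (φ W - φ e) / ε², written so that it makes sense and is C¹ at ε = 0.
  let H : ℝ × (U × V) → F := fun p =>
    φ (K p.2.1 e) + φ (K (x p) (K (x p) e)) + p.1 • φ (K (x p) (K (x p) (K (x p) (W p))))
  let v₀ : V := ⟨w, hw⟩
  let p₀ : ℝ × (U × V) := (0, z₀, v₀)
  have hx : ContDiff ℝ 1 x := by
    have : ContDiff ℝ 1 (fun p : ℝ × (U × V) => (p.2.2 : U)) :=
      V.subtypeL.contDiff.comp (contDiff_snd.comp contDiff_snd)
    fun_prop
  have hk : ContDiff ℝ 1 (fun p : ℝ × (U × V) => (1 : Y →L[ℝ] Y) - p.1 • K (x p)) := by fun_prop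
  have hk0 : 1 - p₀.1 • K (x p₀) = 1 := by simp [p₀]
  have hW : ContDiffAt ℝ 1 W p₀ := by
    have h1 : ContDiffAt ℝ 1 (fun p => Ring.inverse (1 - p.1 • K (x p))) p₀ := by
      have h2 := contDiffAt_ringInverse (R := Y →L[ℝ] Y) ℝ (n := 1) 1
      rw [Units.val_one, ← hk0] at h2
      exact h2.comp p₀ hk.contDiffAt
    exact h1.clm_apply contDiffAt_const
  have hW0 : W p₀ = e := by simp only [W, hk0, Ring.inverse_one]; rfl
  have hH : ContDiffAt ℝ 1 H p₀ := by
    have hx' := hx.contDiffAt (x := p₀)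
    fun_prop
  have hx0 : ∀ q : U × V, x (0, q) = q.2 := fun q => by simp [x]
  have hH0 : ∀ q : U × V, H (0, q) = φ (K q.1 e) + φ (K q.2 (K q.2 e)) := fun q => by
    simp [H, hx0]
  have hHp : H p₀ = 0 := by rw [hH0]; exact hz₀
  have hline : ∀ y, ∃ ν, HasDerivAt (fun t : ℝ => H (0, (z₀, v₀) + t • ν)) y 0 := by
    intro y
    obtain ⟨z, v, hv, rfl⟩ := hsurj y
    refine ⟨(z, ⟨v, hv⟩), ?_⟩
    have h0 : HasDerivAt (fun t : ℝ => z₀ + t • z) z 0 := by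
      simpa using ((hasDerivAt_id (0 : ℝ)).smul_const z).const_add z₀
    have h1 : HasDerivAt (fun t : ℝ => w + t • v) v 0 := by
      simpa using ((hasDerivAt_id (0 : ℝ)).smul_const v).const_add w
    have h2 : HasDerivAt (fun t : ℝ => K (w + t • v)) (K v) 0 := K.hasFDerivAt.comp_hasDerivAt 0 h1
    have h3 := h2.clm_apply (h2.clm_apply (hasDerivAt_const (0 : ℝ) e))
    have h4 := φ.hasFDerivAt.comp_hasDerivAt (0 : ℝ) h3
    have h5 := L.hasFDerivAt.comp_hasDerivAt (0 : ℝ) h0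
    have h6 := h5.add h4
    have hf : (fun t : ℝ => H (0, (z₀, v₀) + t • (z, (⟨v, hv⟩ : V)))) =
        fun t => φ (K (z₀ + t • z) e) + φ (K (w + t • v) (K (w + t • v) e)) :=
      funext fun t => hH0 _
    rw [hf]
    refine h6.congr_deriv ?_
    simp only [zero_smul, add_zero, map_zero, map_add, hL]
    rw [add_comm (φ (K w _))]
  let N : Set (ℝ × (U × V)) :=
    {p | IsUnit (1 - p.1 • K (x p)) ∧ ‖W p - e‖ < ρ ∧ ‖x p‖ < ‖w‖ + 1}
  have hN : N ∈ 𝓝 p₀ := by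
    have h1 : ∀ᶠ p in 𝓝 p₀, IsUnit (1 - p.1 • K (x p)) :=
      hk.continuous.continuousAt.eventually (Units.isOpen.mem_nhds (by simp [hk0]))
    have h2 : ∀ᶠ p in 𝓝 p₀, ‖W p - e‖ < ρ := by
      have := (hW.continuousAt.sub (continuousAt_const (y := e))).norm
      exact this.eventually (gt_mem_nhds (by simpa [hW0] using hρ))
    have h3 : ∀ᶠ p in 𝓝 p₀, ‖x p‖ < ‖w‖ + 1 :=
      hx.continuous.norm.continuousAt.eventually (gt_mem_nhds (by simp [p₀, hx0, v₀]))
    filter_upwards [h1, h2, h3] with p a b c using ⟨a, b, c⟩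
  have hev := eventually_exists_eq_of_surj hH hline hN
  change ∀ᶠ x in 𝓝 ((0 : ℝ), H p₀), _ at hev
  rw [hHp] at hev
  obtain ⟨r, hr, hball⟩ := Metric.eventually_nhds_iff.1 hev
  refine ⟨r, hr, ‖w‖ + 1, by positivity, fun ε hε y hy => ?_⟩
  obtain ⟨⟨z, v⟩, ⟨hu, hWρ, hxn⟩, hHy⟩ := hball (y := (ε, y)) (by
    simpa [Prod.dist_eq, dist_zero_right] using ⟨hε, hy⟩)
  set p : ℝ × (U × V) := (ε, z, v)
  have hfix : W p = e + K (ε • x p) (W p) := by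
    have h1 : (1 - ε • K (x p)) (W p) = e :=
      DFunLike.congr_fun (Ring.mul_inverse_cancel _ hu) e
    rw [map_smul]
    exact eq_add_of_sub_eq h1
  refine ⟨ε • x p, W p, ?_, hfix, hWρ, ?_⟩
  · rw [norm_smul, mul_comm, Real.norm_eq_abs]
    exact mul_le_mul_of_nonneg_right hxn.le (abs_nonneg _)
  · have hfix' : W p = e + ε • K (x p) (W p) := by simpa using hfix
    -- Substituting the fixed point equation into itself gives an exact expansion whose cubic
    -- remainder still contains W.
    have h1 : W p = e + ε • K (x p) e + ε ^ 2 • K (x p) (K (x p) e)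
        + ε ^ 3 • K (x p) (K (x p) (K (x p) (W p))) := by
      conv_lhs => rw [hfix', hfix', hfix']
      simp only [map_add, map_smul, smul_add, smul_smul]
      rw [add_assoc, add_assoc, pow_two, pow_three]
    have h2 : φ (K (x p) e) = ε • φ (K z e) := by
      have hv : φ (K (v : U) e) = 0 := v.2
      simp only [x, p, map_add, map_smul, add_apply, FunLike.coe_smul, Pi.smul_apply]
      simp [hv]
    change H p = y at hHy
    rw [← hHy]
    conv_lhs => rw [h1]
    simp only [map_add, map_smul, h2, H, smul_add, smul_smul, p]
    rw [add_assoc, add_assoc, add_assoc, pow_two, pow_succ, pow_two]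

end SympControl

/-! ### Oscillating profiles and their moments. -/

namespace SympControl
open intervalIntegral

section Profiles

/-- A sequence of functions on the line, each the derivative of the previous one, vanishing
outside the interval `(p, p + 1)`. -/
structure IsChain (p : ℕ) (h : ℕ → ℝ → ℝ) : Prop where
  deriv : ∀ j t, HasDerivAt (h j) (h (j + 1) t) t
  zero : ∀ j t, t ∉ Ioo (p : ℝ) (p + 1) → h j t = 0

lemma IsChain.continuous {p : ℕ} {h : ℕ → ℝ → ℝ} (hh : IsChain p h) (j : ℕ) : Continuous (h j) :=
  continuous_iff_continuousAt.2 fun t => (hh.deriv j t).continuousAt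

lemma IsChain.shift {p : ℕ} {h : ℕ → ℝ → ℝ} (hh : IsChain p h) (n : ℕ) :
    IsChain p (fun j => h (j + n)) :=
  ⟨fun j t => by simpa only [add_right_comm] using hh.deriv (j + n) t, fun j t => hh.zero _ t⟩

lemma IsChain.add {p : ℕ} {h h' : ℕ → ℝ → ℝ} (hh : IsChain p h) (hh' : IsChain p h') :
    IsChain p (fun j t => h j t + h' j t) :=
  ⟨fun j t => (hh.deriv j t).add (hh'.deriv j t), fun j t ht => by
    simp only [hh.zero j t ht, hh'.zero j t ht, add_zero]⟩

lemma IsChain.const_mul {p : ℕ} {h : ℕ → ℝ → ℝ} (hh : IsChain p h) (c : ℝ) :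
    IsChain p (fun j t => c * h j t) :=
  ⟨fun j t => (hh.deriv j t).const_mul c, fun j t ht => by
    simp only [hh.zero j t ht, mul_zero]⟩

lemma IsChain.translate {h : ℕ → ℝ → ℝ} (hh : IsChain 0 h) (p : ℕ) :
    IsChain p (fun j t => h j (t - p)) :=
  ⟨fun j t => (hh.deriv j (t - p)).comp_sub_const t p, fun j t ht => hh.zero j _ fun h' => ht (by
    simp only [Nat.cast_zero, zero_add, mem_Ioo] at h'
    exact ⟨by linarith [h'.1], by linarith [h'.2]⟩)⟩

/-- The chain consists of the successive derivatives of a smooth bump. None of them vanishes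
identically: its predecessor would be constant, hence zero by compact support. -/
lemma exists_isChain :
    ∃ D : ℕ → ℝ → ℝ, IsChain 0 D ∧ ∀ j, 0 < ∫ t in (0 : ℝ)..1, D j t ^ 2 := by
  let F : ContDiffBump (1 / 2 : ℝ) := ⟨1 / 8, 1 / 4, by norm_num, by norm_num⟩
  have hF : ContDiff ℝ ∞ F := F.contDiff
  have hts : ∀ j, tsupport (iteratedDeriv j F) ⊆ Metric.closedBall (1 / 2 : ℝ) (1 / 4) := by
    intro j
    induction j with
    | zero => rw [iteratedDeriv_zero, F.tsupport_eq]
    | succ j ih =>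
      rw [iteratedDeriv_succ]
      exact (closure_minimal support_deriv_subset (isClosed_tsupport _)).trans ih
  have hc : IsChain 0 (fun j => iteratedDeriv j F) := by
    refine ⟨fun j t => ?_, fun j t ht => ?_⟩
    · rw [iteratedDeriv_succ]
      exact (hF.differentiable_iteratedDeriv j (by exact_mod_cast ENat.natCast_lt_top j) t).hasDerivAt
    · refine image_eq_zero_of_notMem_tsupport fun h => ht ?_
      have := hts j h
      rw [Real.closedBall_eq_Icc] at this
      simp only [Nat.cast_zero, zero_add, mem_Ioo]
      exact ⟨by linarith [this.1], by linarith [this.2]⟩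
  refine ⟨_, hc, fun j => ?_⟩
  have hne : ∀ j, ∃ t, iteratedDeriv j F t ≠ 0 := by
    intro j
    induction j with
    | zero =>
      refine ⟨1 / 2, ?_⟩
      rw [iteratedDeriv_zero, F.one_of_mem_closedBall (Metric.mem_closedBall_self F.rIn_pos.le)]
      norm_num
    | succ j ih =>
      by_contra! h
      obtain ⟨t, ht⟩ := ih
      refine ht ?_
      have := is_const_of_deriv_eq_zero (fun s => (hc.deriv j s).differentiableAt)
        (fun s => (hc.deriv j s).deriv.trans (h s)) t 2
      exact this.trans (hc.zero j 2 (by norm_num))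
  obtain ⟨t, ht⟩ := hne j
  have htI : t ∈ Ioo (0 : ℝ) 1 := by
    by_contra h
    exact ht (hc.zero j t (by simpa using h))
  exact integral_pos one_pos ((hc.continuous j).pow 2).continuousOn (fun s _ => sq_nonneg _)
    ⟨t, Ioo_subset_Icc_self htI, by positivity⟩

lemma integral_sq_translate {D : ℕ → ℝ → ℝ} (hD : IsChain 0 D) (j : ℕ) {p N : ℕ} (hp : p < N) :
    ∫ t in (0 : ℝ)..N, D j (t - p) ^ 2 = ∫ t in (0 : ℝ)..1, D j t ^ 2 := by
  have hp' : (p : ℝ) + 1 ≤ N := by exact_mod_cast hp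
  have hi : ∀ a b : ℝ, IntervalIntegrable (fun t => D j t ^ 2) volume a b :=
    fun a b => ((hD.continuous j).pow 2).intervalIntegrable a b
  have h0 : ∀ a b : ℝ, (∀ t ∈ uIcc a b, t ∉ Ioo (0 : ℝ) 1) → ∫ t in a..b, D j t ^ 2 = 0 := by
    intro a b hab
    rw [integral_congr (g := fun _ => 0) fun t ht => ?_, intervalIntegral.integral_zero]
    have := hD.zero j t (by simpa using hab t ht)
    simp [this]
  rw [intervalIntegral.integral_comp_sub_right (fun t => D j t ^ 2),
    ← integral_add_adjacent_intervals (hi _ 0) (hi 0 _),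
    ← integral_add_adjacent_intervals (hi 0 1) (hi 1 _), h0 _ 0, h0 1, zero_add, add_zero]
  · intro t ht h
    rw [uIcc_of_le (by linarith)] at ht
    exact absurd h.2 (not_lt.2 ht.1)
  · intro t ht h
    rw [uIcc_of_le (by simp)] at ht
    exact absurd h.1 (not_lt.2 ht.2)

/-- The compactly supported primitive of `t ^ b * h 4 t`, for `b ≤ 3`. -/
def momentPrimitive (h : ℕ → ℝ → ℝ) : ℕ → ℝ → ℝ
  | 0, t => h 3 t
  | 1, t => t * h 3 t - h 2 t
  | 2, t => t ^ 2 * h 3 t - 2 * t * h 2 t + 2 * h 1 t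
  | 3, t => t ^ 3 * h 3 t - 3 * t ^ 2 * h 2 t + 6 * t * h 1 t - 6 * h 0 t
  | _ + 4, _ => 0

variable {p q N : ℕ} {h h' : ℕ → ℝ → ℝ}

lemma IsChain.hasDerivAt_momentPrimitive (hh : IsChain p h) {b : ℕ} (hb : b < 4) (t : ℝ) :
    HasDerivAt (momentPrimitive h b) (t ^ b * h 4 t) t := by
  have h0 := hh.deriv 0 t
  have h1 := hh.deriv 1 t
  have h2 := hh.deriv 2 t
  have h3 := hh.deriv 3 t
  have hi := hasDerivAt_id' t
  interval_cases b
  · exact h3.congr_deriv (by ring)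
  · exact ((hi.mul h3).sub h2).congr_deriv (by ring)
  · exact ((((hi.pow 2).mul h3).sub ((hi.const_mul 2).mul h2)).add (h1.const_mul 2)).congr_deriv
      (by norm_num; ring)
  · exact (((((hi.pow 3).mul h3).sub (((hi.pow 2).const_mul 3).mul h2)).add
      ((hi.const_mul 6).mul h1)).sub (h0.const_mul 6)).congr_deriv (by norm_num; ring)

lemma IsChain.momentPrimitive_eq_zero (hh : IsChain p h) (b : ℕ) {t : ℝ}
    (ht : t ∉ Ioo (p : ℝ) (p + 1)) : momentPrimitive h b t = 0 := by
  match b with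
  | 0 | 1 | 2 | 3 | _ + 4 => simp [momentPrimitive, hh.zero _ t ht]

lemma IsChain.continuous_momentPrimitive (hh : IsChain p h) {b : ℕ} (hb : b < 4) :
    Continuous (momentPrimitive h b) :=
  continuous_iff_continuousAt.2 fun t => (hh.hasDerivAt_momentPrimitive hb t).continuousAt

lemma IsChain.integral_moment (hh : IsChain p h) {b : ℕ} (hb : b < 4) (t : ℝ) :
    ∫ s in (0 : ℝ)..t, s ^ b * h 4 s = momentPrimitive h b t := by
  rw [integral_eq_sub_of_hasDerivAt (fun s _ => hh.hasDerivAt_momentPrimitive hb s)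
    (((continuous_pow b).mul (hh.continuous 4)).intervalIntegrable _ _),
    hh.momentPrimitive_eq_zero b (t := 0) (by simp), sub_zero]

lemma notMem_Ioo_of_lt (hp : p < N) : (N : ℝ) ∉ Ioo (p : ℝ) (p + 1) := fun h =>
  absurd h.2 (not_lt.2 (by exact_mod_cast hp))

/-- The double moments `∫ t ^ a * h 4 t * ∫₀ᵗ s ^ b * h' 4 s ds dt`. -/
noncomputable def doubleMoment (N : ℕ) (h h' : ℕ → ℝ → ℝ) (a b : ℕ) : ℝ :=
  ∫ t in (0 : ℝ)..N, t ^ a * h 4 t * momentPrimitive h' b t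

/-- Not only `h' 4` but also the primitives of its moments are supported in the window of `h'`,
which is disjoint from that of `h`. -/
lemma doubleMoment_eq_zero (hh : IsChain p h) (hh' : IsChain q h') (hpq : p ≠ q) (a b : ℕ) :
    doubleMoment N h h' a b = 0 := by
  rw [doubleMoment, integral_congr (g := fun _ => 0) fun t _ => ?_, intervalIntegral.integral_zero]
  by_cases ht : t ∈ Ioo (p : ℝ) (p + 1)
  · have : t ∉ Ioo (q : ℝ) (q + 1) := fun ht' => hpq <| by
      have h1 : (p : ℝ) < q + 1 := ht.1.trans ht'.2
      have h2 : (q : ℝ) < p + 1 := ht'.1.trans ht.2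
      have h1' : p < q + 1 := by exact_mod_cast h1
      have h2' : q < p + 1 := by exact_mod_cast h2
      omega
    simp [hh'.momentPrimitive_eq_zero b this]
  · simp [hh.zero 4 t ht]

/-- Integration by parts; the boundary terms vanish because both primitives are supported in their
windows. -/
lemma doubleMoment_swap (hh : IsChain p h) (hh' : IsChain q h') (hp : p < N)
    {a b : ℕ} (ha : a < 4) (hb : b < 4) :
    doubleMoment N h h' a b = -doubleMoment N h' h b a := by
  have c1 := hh.continuous_momentPrimitive ha
  have c2 := hh'.continuous_momentPrimitive hb
  have c3 := hh.continuous 4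
  have c4 := hh'.continuous 4
  rw [eq_neg_iff_add_eq_zero, doubleMoment, doubleMoment, ← intervalIntegral.integral_add
    (Continuous.intervalIntegrable (by fun_prop) _ _)
    (Continuous.intervalIntegrable (by fun_prop) _ _),
    integral_eq_sub_of_hasDerivAt (f := fun t => momentPrimitive h a t * momentPrimitive h' b t)
      (fun t _ => ?_) (Continuous.intervalIntegrable (by fun_prop) _ _),
    hh.momentPrimitive_eq_zero a (notMem_Ioo_of_lt hp),
    hh.momentPrimitive_eq_zero a (t := 0) (by simp)]
  · simp
  · exact ((hh.hasDerivAt_momentPrimitive ha t).mul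
      (hh'.hasDerivAt_momentPrimitive hb t)).congr_deriv (by ring)

/-- A pair of profiles for which the symmetric double moments of order at most two vanish, and
the antisymmetric one does not. -/
lemma exists_profiles : ∃ c > 0, ∀ p : ℕ, ∃ f g : ℕ → ℝ → ℝ, IsChain p f ∧ IsChain p g ∧
    ∀ N, p < N → doubleMoment N f g 1 0 = doubleMoment N f g 0 1 ∧
      doubleMoment N f g 2 0 = doubleMoment N f g 0 2 ∧
      doubleMoment N f g 1 1 - doubleMoment N f g 0 2 = c := by
  obtain ⟨D₀, hD₀, hpos⟩ := exists_isChain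
  set A₃ := ∫ t in (0 : ℝ)..1, D₀ 3 t ^ 2
  set A₄ := ∫ t in (0 : ℝ)..1, D₀ 4 t ^ 2
  have hA₃ : 0 < A₃ := hpos 3
  have hA₄ : 0 < A₄ := hpos 4
  -- With g = D' + κ D''', the second order symmetric condition reduces to A₃ - 3 κ A₄ = 0. The
  -- first order one holds for every κ, its integrand being an exact derivative; the antisymmetric
  -- moment is then 2 A₃ / 3.
  set κ := A₃ / (3 * A₄)
  have hκ : κ * A₄ = A₃ / 3 := by simp only [κ]; field_simp
  refine ⟨2 / 3 * A₃, by positivity, fun p => ?_⟩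
  set D : ℕ → ℝ → ℝ := fun j t => D₀ j (t - p)
  have hD : IsChain p D := hD₀.translate p
  refine ⟨D, fun j t => D (j + 1) t + κ * D (j + 3) t, hD,
    (hD.shift 1).add ((hD.shift 3).const_mul κ), fun N hN => ?_⟩
  have e3 : ∫ t in (0 : ℝ)..N, D 3 t ^ 2 = A₃ := integral_sq_translate hD₀ 3 hN
  have e4 : ∫ t in (0 : ℝ)..N, D 4 t ^ 2 = A₄ := integral_sq_translate hD₀ 4 hN
  have z0 : ∀ j, D j 0 = 0 := fun j => hD.zero j 0 (by simp)
  have zN : ∀ j, D j N = 0 := fun j => hD.zero j N (notMem_Ioo_of_lt hN)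
  have c := hD.continuous
  have d := hD.deriv
  have I1 : ∫ t in (0 : ℝ)..N, D 4 t * (D 3 t + κ * D 5 t) = 0 := by
    rw [integral_eq_sub_of_hasDerivAt
      (f := fun t => (1 / 2) * D 3 t ^ 2 + κ * (1 / 2) * D 4 t ^ 2)
      (fun t _ => ?_) (Continuous.intervalIntegrable (by fun_prop) _ _)]
    · simp [z0, zN]
    · exact ((((d 3 t).pow 2).const_mul _).add (((d 4 t).pow 2).const_mul _)).congr_deriv
        (by norm_num; ring)
  have I2 : ∫ t in (0 : ℝ)..N, D 4 t * (D 2 t + κ * D 4 t) = -A₃ + κ * A₄ := by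
    rw [← e3, ← e4, ← intervalIntegral.integral_neg, ← intervalIntegral.integral_const_mul, ← intervalIntegral.integral_add
      (Continuous.intervalIntegrable (by fun_prop) _ _)
      (Continuous.intervalIntegrable (by fun_prop) _ _), ← sub_eq_zero, ← intervalIntegral.integral_sub
      (Continuous.intervalIntegrable (by fun_prop) _ _)
      (Continuous.intervalIntegrable (by fun_prop) _ _),
      integral_eq_sub_of_hasDerivAt (f := fun t => D 3 t * D 2 t)
      (fun t _ => ?_) (Continuous.intervalIntegrable (by fun_prop) _ _)]
    · simp [z0, zN]
    · exact ((d 3 t).mul (d 2 t)).congr_deriv (by ring)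
  have I3 : ∫ t in (0 : ℝ)..N, D 4 t * (t * (D 3 t + κ * D 5 t)) =
      -(1 / 2) * A₃ - 1 / 2 * (κ * A₄) := by
    rw [← e3, ← e4, ← intervalIntegral.integral_const_mul, ← intervalIntegral.integral_const_mul, ← intervalIntegral.integral_const_mul,
      ← intervalIntegral.integral_sub
      (Continuous.intervalIntegrable (by fun_prop) _ _)
      (Continuous.intervalIntegrable (by fun_prop) _ _), ← sub_eq_zero, ← intervalIntegral.integral_sub
      (Continuous.intervalIntegrable (by fun_prop) _ _)
      (Continuous.intervalIntegrable (by fun_prop) _ _),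
      integral_eq_sub_of_hasDerivAt
        (f := fun t => (1 / 2) * (t * D 3 t ^ 2) + κ * (1 / 2) * (t * D 4 t ^ 2))
      (fun t _ => ?_) (Continuous.intervalIntegrable (by fun_prop) _ _)]
    · simp [z0, zN]
    · exact ((((hasDerivAt_id' t).mul ((d 3 t).pow 2)).const_mul _).add
        (((hasDerivAt_id' t).mul ((d 4 t).pow 2)).const_mul _)).congr_deriv
        (by norm_num; ring)
  refine ⟨?_, ?_, ?_⟩
  · rw [← sub_eq_zero, ← I1, doubleMoment, doubleMoment, ← intervalIntegral.integral_sub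
      (Continuous.intervalIntegrable (by simp only [momentPrimitive]; fun_prop) _ _)
      (Continuous.intervalIntegrable (by simp only [momentPrimitive]; fun_prop) _ _)]
    refine integral_congr fun t _ => ?_
    simp only [momentPrimitive]
    ring
  · have : (0 : ℝ) = 2 * (-(1 / 2) * A₃ - 1 / 2 * (κ * A₄)) - 2 * (-A₃ + κ * A₄) := by
      rw [hκ]; ring
    rw [← sub_eq_zero, this, ← I3, ← I2, ← intervalIntegral.integral_const_mul, ← intervalIntegral.integral_const_mul,
      doubleMoment, doubleMoment, ← intervalIntegral.integral_sub
      (Continuous.intervalIntegrable (by simp only [momentPrimitive]; fun_prop) _ _)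
      (Continuous.intervalIntegrable (by simp only [momentPrimitive]; fun_prop) _ _),
      ← intervalIntegral.integral_sub
      (Continuous.intervalIntegrable (by fun_prop) _ _)
      (Continuous.intervalIntegrable (by fun_prop) _ _)]
    refine integral_congr fun t _ => ?_
    simp only [momentPrimitive]
    ring
  · have : 2 / 3 * A₃ = (-(1 / 2) * A₃ - 1 / 2 * (κ * A₄)) - 2 * (-A₃ + κ * A₄) := by
      rw [hκ]; ring
    rw [this, ← I3, ← I2, ← intervalIntegral.integral_const_mul,
      doubleMoment, doubleMoment, ← intervalIntegral.integral_sub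
      (Continuous.intervalIntegrable (by simp only [momentPrimitive]; fun_prop) _ _)
      (Continuous.intervalIntegrable (by simp only [momentPrimitive]; fun_prop) _ _),
      ← intervalIntegral.integral_sub
      (Continuous.intervalIntegrable (by fun_prop) _ _)
      (Continuous.intervalIntegrable (by fun_prop) _ _)]
    refine integral_congr fun t _ => ?_
    simp only [momentPrimitive]
    ring

end Profiles

end SympControl

/-! ### Iterated integrals of rescaled curves and their small-scale expansion. -/

namespace SympControl
open intervalIntegral Filter Topology

section IteratedIntegral
variable {𝔸 : Type*} [NormedRing 𝔸] [NormedAlgebra ℝ 𝔸]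

/-- The iterated integral `∫₀ᴺ X(t) ∫₀ᵗ Y(s) ds dt`. -/
noncomputable def iterInt (N : ℝ) (X Y : ℝ → 𝔸) : 𝔸 :=
  ∫ t in (0 : ℝ)..N, X t * ∫ s in (0 : ℝ)..t, Y s

lemma continuous_integral {E : Type*} [NormedAddCommGroup E] [NormedSpace ℝ E] {Y : ℝ → E}
    (hY : Continuous Y) : Continuous fun t => ∫ s in (0 : ℝ)..t, Y s :=
  continuous_primitive (fun a b => hY.intervalIntegrable a b) 0

lemma iterInt_add_left (N : ℝ) {X X' Y : ℝ → 𝔸} (hX : Continuous X) (hX' : Continuous X')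
    (hY : Continuous Y) :
    iterInt N (fun t => X t + X' t) Y = iterInt N X Y + iterInt N X' Y := by
  have := continuous_integral hY
  rw [iterInt, iterInt, iterInt, ← intervalIntegral.integral_add
    (Continuous.intervalIntegrable (by fun_prop) _ _)
    (Continuous.intervalIntegrable (by fun_prop) _ _)]
  simp only [add_mul]

lemma iterInt_add_right (N : ℝ) {X Y Y' : ℝ → 𝔸} (hX : Continuous X) (hY : Continuous Y)
    (hY' : Continuous Y') :
    iterInt N X (fun t => Y t + Y' t) = iterInt N X Y + iterInt N X Y' := by
  have := continuous_integral hY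
  have := continuous_integral hY'
  rw [iterInt, iterInt, iterInt, ← intervalIntegral.integral_add
    (Continuous.intervalIntegrable (by fun_prop) _ _)
    (Continuous.intervalIntegrable (by fun_prop) _ _)]
  refine integral_congr fun t _ => ?_
  rw [intervalIntegral.integral_add (hY.intervalIntegrable _ _) (hY'.intervalIntegrable _ _),
    mul_add]

lemma norm_iterInt_le {N a b : ℝ} (hN : 0 ≤ N) {X Y : ℝ → 𝔸}
    (hX : ∀ t ∈ Icc 0 N, ‖X t‖ ≤ a) (hY : ∀ t ∈ Icc 0 N, ‖Y t‖ ≤ b) :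
    ‖iterInt N X Y‖ ≤ N ^ 2 * (a * b) := by
  have h0 : (0 : ℝ) ∈ Icc 0 N := ⟨le_rfl, hN⟩
  have ha : 0 ≤ a := (norm_nonneg _).trans (hX 0 h0)
  have hb : 0 ≤ b := (norm_nonneg _).trans (hY 0 h0)
  have h1 : ∀ t ∈ Icc 0 N, ‖∫ s in (0 : ℝ)..t, Y s‖ ≤ b * N := fun t ht => by
    refine (intervalIntegral.norm_integral_le_of_norm_le_const (C := b) fun s hs => ?_).trans ?_
    · rw [uIoc_of_le ht.1] at hs
      exact hY s ⟨hs.1.le, hs.2.trans ht.2⟩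
    · rw [sub_zero, abs_of_nonneg ht.1]
      exact mul_le_mul_of_nonneg_left ht.2 hb
  refine (intervalIntegral.norm_integral_le_of_norm_le_const (C := a * (b * N)) fun t ht => ?_).trans_eq ?_
  · rw [uIoc_of_le hN] at ht
    have ht' : t ∈ Icc 0 N := Ioc_subset_Icc_self ht
    exact (norm_mul_le _ _).trans (mul_le_mul (hX t ht') (h1 t ht') (norm_nonneg _) ha)
  · rw [sub_zero, abs_of_nonneg hN]
    ring

/-- Change of scale for functions vanishing outside `[0,N]`. -/
lemma integral_scale {E : Type*} [NormedAddCommGroup E] [NormedSpace ℝ E] {T N η : ℝ}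
    (hη : 0 < η) (hT : η * N ≤ T) {X : ℝ → E} (hX : Continuous X) (hX0 : ∀ t, N ≤ t → X t = 0) :
    ∫ t in (0 : ℝ)..T, X (t / η) = η • ∫ t in (0 : ℝ)..N, X t := by
  have hN : N ≤ T / η := by rwa [le_div_iff₀ hη, mul_comm]
  rw [integral_comp_div _ hη.ne', zero_div, ← integral_add_adjacent_intervals
    (hX.intervalIntegrable 0 N) (hX.intervalIntegrable N _),
    integral_congr (g := fun _ => 0) (a := N) fun t ht => ?_, intervalIntegral.integral_zero,
    add_zero]
  rw [uIcc_of_le hN] at ht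
  exact hX0 t ht.1

lemma iterInt_scale {T N η : ℝ} (hη : 0 < η) (hT : η * N ≤ T) {X Y : ℝ → 𝔸} (hX : Continuous X)
    (hY : Continuous Y) (hX0 : ∀ t, N ≤ t → X t = 0) :
    iterInt T (fun t => X (t / η)) (fun t => Y (t / η)) = η ^ 2 • iterInt N X Y := by
  have h := continuous_integral hY
  have h1 : ∀ t, ∫ s in (0 : ℝ)..t, Y (s / η) = η • ∫ s in (0 : ℝ)..(t / η), Y s := fun t => by
    rw [integral_comp_div _ hη.ne', zero_div]
  simp only [iterInt, h1, mul_smul_comm]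
  rw [intervalIntegral.integral_smul,
    integral_scale hη hT (X := fun t => X t * ∫ s in (0 : ℝ)..t, Y s) (by fun_prop)
      (fun t ht => by simp [hX0 t ht]), smul_smul, pow_two]

variable [CompleteSpace 𝔸] {p q N : ℕ} {h h' : ℕ → ℝ → ℝ}

lemma IsChain.integral_smul_sum (hh : IsChain p h) {n : ℕ} (hn : n ≤ 4) (a : ℕ → 𝔸) (η t : ℝ) :
    ∫ s in (0 : ℝ)..t, h 4 s • ∑ i ∈ Finset.range n, (η * s) ^ i • a i =
      ∑ i ∈ Finset.range n, (η ^ i * momentPrimitive h i t) • a i := by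
  have hc := hh.continuous 4
  have : ∀ s, h 4 s • ∑ i ∈ Finset.range n, (η * s) ^ i • a i =
      ∑ i ∈ Finset.range n, (η ^ i * (s ^ i * h 4 s)) • a i := fun s => by
    rw [Finset.smul_sum]
    refine Finset.sum_congr rfl fun i _ => ?_
    rw [smul_smul]
    congr 1
    ring
  simp only [this]
  rw [intervalIntegral.integral_finsetSum fun i _ =>
    Continuous.intervalIntegrable (by fun_prop) _ _]
  refine Finset.sum_congr rfl fun i hi => ?_
  rw [intervalIntegral.integral_smul_const, intervalIntegral.integral_const_mul,
    hh.integral_moment (by have := Finset.mem_range.1 hi; omega)]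

lemma iterInt_smul_sum (hh : IsChain p h) (hh' : IsChain q h') (a b : ℕ → 𝔸) (η : ℝ) :
    iterInt N (fun t => h 4 t • ∑ i ∈ Finset.range 3, (η * t) ^ i • a i)
      (fun t => h' 4 t • ∑ i ∈ Finset.range 3, (η * t) ^ i • b i) =
      ∑ i ∈ Finset.range 3, ∑ j ∈ Finset.range 3,
        (η ^ (i + j) * doubleMoment N h h' i j) • (a i * b j) := by
  have hc := hh.continuous 4
  have hm : ∀ j ∈ Finset.range 3, Continuous (momentPrimitive h' j) := fun j hj =>
    hh'.continuous_momentPrimitive (by have := Finset.mem_range.1 hj; omega)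
  simp only [iterInt, hh'.integral_smul_sum (by norm_num : 3 ≤ 4)]
  have : ∀ t, (h 4 t • ∑ i ∈ Finset.range 3, (η * t) ^ i • a i) *
      ∑ j ∈ Finset.range 3, (η ^ j * momentPrimitive h' j t) • b j =
      ∑ i ∈ Finset.range 3, ∑ j ∈ Finset.range 3,
        (η ^ (i + j) * (t ^ i * h 4 t * momentPrimitive h' j t)) • (a i * b j) := fun t => by
    rw [Finset.smul_sum, Finset.sum_mul]
    refine Finset.sum_congr rfl fun i _ => ?_
    rw [Finset.mul_sum]
    refine Finset.sum_congr rfl fun j _ => ?_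
    rw [smul_smul, smul_mul_smul_comm]
    congr 1
    ring
  simp only [this]
  have hi : ∀ i, ∀ j ∈ Finset.range 3, IntervalIntegrable
      (fun t => (η ^ (i + j) * (t ^ i * h 4 t * momentPrimitive h' j t)) • (a i * b j))
      volume 0 (N : ℝ) := fun i j hj => by
    have := hm j hj
    exact Continuous.intervalIntegrable (by fun_prop) _ _
  rw [intervalIntegral.integral_finsetSum fun i _ => by
    have := IntervalIntegrable.sum (Finset.range 3) (hi i)
    simpa only [← Finset.sum_fn] using this]
  refine Finset.sum_congr rfl fun i _ => ?_
  rw [intervalIntegral.integral_finsetSum (hi i)]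
  refine Finset.sum_congr rfl fun j _ => ?_
  rw [intervalIntegral.integral_smul_const, intervalIntegral.integral_const_mul, doubleMoment]

/-- Small-scale expansion of the iterated integral of two rescaled curves of `[0,T]`. -/
lemma tendsto_iterInt_block {T : ℝ} (hT : 0 < T) {C C' : ℝ → 𝔸} (hC : Continuous C)
    (hC' : Continuous C') {a b : ℕ → 𝔸} {K : ℝ}
    (ha : ∀ x ∈ Icc 0 T, ‖C x - ∑ i ∈ Finset.range 3, x ^ i • a i‖ ≤ K * x ^ 3)
    (hb : ∀ x ∈ Icc 0 T, ‖C' x - ∑ i ∈ Finset.range 3, x ^ i • b i‖ ≤ K * x ^ 3)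
    (hab : a 0 * b 0 = 0) (hh : IsChain p h) (hh' : IsChain q h') :
    Tendsto (fun η : ℝ => (η ^ 2)⁻¹ • iterInt N (fun t => h 4 t • C (η * t))
        (fun t => h' 4 t • C' (η * t)) - η⁻¹ • (doubleMoment N h h' 1 0 • (a 1 * b 0) +
          doubleMoment N h h' 0 1 • (a 0 * b 1))) (𝓝[>] 0)
      (𝓝 (doubleMoment N h h' 2 0 • (a 2 * b 0) + doubleMoment N h h' 1 1 • (a 1 * b 1) +
        doubleMoment N h h' 0 2 • (a 0 * b 2))) := by
  have hc := hh.continuous 4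
  have hc' := hh'.continuous 4
  obtain ⟨m, hm⟩ := isCompact_Icc.exists_bound_of_continuousOn
    (s := Icc (0 : ℝ) N) hc.continuousOn
  obtain ⟨m', hm'⟩ := isCompact_Icc.exists_bound_of_continuousOn
    (s := Icc (0 : ℝ) N) hc'.continuousOn
  obtain ⟨M', hM'⟩ := isCompact_Icc.exists_bound_of_continuousOn
    (s := Icc (0 : ℝ) T) hC'.continuousOn
  obtain ⟨M, hM⟩ := isCompact_Icc.exists_bound_of_continuousOn
    (s := Icc (0 : ℝ) T) (f := fun x => ∑ i ∈ Finset.range 3, x ^ i • a i)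
    (Continuous.continuousOn (by fun_prop))
  have h0N : (0 : ℝ) ∈ Icc (0 : ℝ) N := ⟨le_rfl, N.cast_nonneg⟩
  have h0T : (0 : ℝ) ∈ Icc (0 : ℝ) T := ⟨le_rfl, hT.le⟩
  have pm : 0 ≤ m := (norm_nonneg _).trans (hm 0 h0N)
  have pm' : 0 ≤ m' := (norm_nonneg _).trans (hm' 0 h0N)
  have pM' : 0 ≤ M' := (norm_nonneg _).trans (hM' 0 h0T)
  have pM : 0 ≤ M := (norm_nonneg _).trans (hM 0 h0T)
  have pK : 0 ≤ K := by
    have := (norm_nonneg _).trans (ha T ⟨hT.le, le_rfl⟩)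
    exact nonneg_of_mul_nonneg_left this (by positivity)
  set R : ℝ → 𝔸 := fun η => iterInt N (fun t => h 4 t • C (η * t))
        (fun t => h' 4 t • C' (η * t)) - ∑ i ∈ Finset.range 3, ∑ j ∈ Finset.range 3,
        (η ^ (i + j) * doubleMoment N h h' i j) • (a i * b j) with hR
  set K' : ℝ := N ^ 2 * (m * (K * N ^ 3) * (m' * M')) + N ^ 2 * (m * M * (m' * (K * N ^ 3)))
  have hev : ∀ᶠ η : ℝ in 𝓝[>] 0, 0 < η ∧ η * N ≤ T := by
    have h1 : ∀ᶠ η : ℝ in 𝓝 0, η * N < T := by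
      have : Tendsto (fun η : ℝ => η * N) (𝓝 0) (𝓝 (0 * N)) :=
        (continuous_id.mul continuous_const).tendsto 0
      rw [zero_mul] at this
      exact this.eventually (gt_mem_nhds hT)
    filter_upwards [self_mem_nhdsWithin, nhdsWithin_le_nhds h1] with η a b using ⟨a, b.le⟩
  have hRle : ∀ᶠ η : ℝ in 𝓝[>] 0, ‖(η ^ 2)⁻¹ • R η‖ ≤ K' * η := by
    filter_upwards [hev] with η ⟨hη, hηT⟩
    have hmem : ∀ t ∈ Icc (0 : ℝ) N, η * t ∈ Icc 0 T := fun t ht =>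
      ⟨mul_nonneg hη.le ht.1, (mul_le_mul_of_nonneg_left ht.2 hη.le).trans hηT⟩
    have hcube : ∀ t ∈ Icc (0 : ℝ) N, K * (η * t) ^ 3 ≤ K * N ^ 3 * η ^ 3 := fun t ht => by
      have := ht.1
      have := ht.2
      calc K * (η * t) ^ 3 ≤ K * (η * N) ^ 3 := by gcongr
        _ = _ := by ring
    set P : ℝ → 𝔸 := fun x => ∑ i ∈ Finset.range 3, x ^ i • a i with hP
    set P' : ℝ → 𝔸 := fun x => ∑ i ∈ Finset.range 3, x ^ i • b i with hP'
    have cP : Continuous P := by fun_prop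
    have cP' : Continuous P' := by fun_prop
    -- The two curves are replaced by their Taylor polynomials one at a time; each replacement costs
    -- O(η³) while the other factor stays bounded.
    have hdec : R η = iterInt N (fun t => h 4 t • (C (η * t) - P (η * t)))
          (fun t => h' 4 t • C' (η * t)) +
        iterInt N (fun t => h 4 t • P (η * t)) (fun t => h' 4 t • (C' (η * t) - P' (η * t))) := by
      rw [hR]
      beta_reduce
      rw [← iterInt_smul_sum hh hh' a b η]
      have e1 : iterInt N (fun t => h 4 t • C (η * t)) (fun t => h' 4 t • C' (η * t)) =
          iterInt N (fun t => h 4 t • (C (η * t) - P (η * t))) (fun t => h' 4 t • C' (η * t)) +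
          iterInt N (fun t => h 4 t • P (η * t)) (fun t => h' 4 t • C' (η * t)) := by
        rw [← iterInt_add_left N (by fun_prop) (by fun_prop) (by fun_prop)]
        simp only [← smul_add, sub_add_cancel]
      have e2 : iterInt N (fun t => h 4 t • P (η * t)) (fun t => h' 4 t • C' (η * t)) =
          iterInt N (fun t => h 4 t • P (η * t)) (fun t => h' 4 t • (C' (η * t) - P' (η * t))) +
          iterInt N (fun t => h 4 t • P (η * t)) (fun t => h' 4 t • P' (η * t)) := by
        rw [← iterInt_add_right N (by fun_prop) (by fun_prop) (by fun_prop)]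
        simp only [← smul_add, sub_add_cancel]
      rw [e1, e2]
      simp only [hP, hP']
      abel
    have b1 : ‖R η‖ ≤ K' * η ^ 3 := by
      rw [hdec]
      refine (norm_add_le _ _).trans ?_
      refine (add_le_add
        (norm_iterInt_le (a := m * (K * N ^ 3 * η ^ 3)) (b := m' * M') N.cast_nonneg ?_ ?_)
        (norm_iterInt_le (a := m * M) (b := m' * (K * N ^ 3 * η ^ 3)) N.cast_nonneg ?_ ?_)).trans_eq
        (by ring)
      · intro t ht
        rw [norm_smul]
        exact mul_le_mul (hm t ht) ((ha _ (hmem t ht)).trans (hcube t ht)) (norm_nonneg _) pm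
      · intro t ht
        rw [norm_smul]
        exact mul_le_mul (hm' t ht) (hM' _ (hmem t ht)) (norm_nonneg _) pm'
      · intro t ht
        rw [norm_smul]
        exact mul_le_mul (hm t ht) (hM _ (hmem t ht)) (norm_nonneg _) pm
      · intro t ht
        rw [norm_smul]
        exact mul_le_mul (hm' t ht) ((hb _ (hmem t ht)).trans (hcube t ht)) (norm_nonneg _) pm'
    rw [norm_smul, norm_inv, norm_pow, Real.norm_of_nonneg hη.le, inv_mul_le_iff₀ (by positivity)]
    exact b1.trans_eq (by ring)
  have hR0 : Tendsto (fun η : ℝ => (η ^ 2)⁻¹ • R η) (𝓝[>] 0) (𝓝 0) := by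
    refine squeeze_zero_norm' hRle ?_
    have : Tendsto (fun η : ℝ => K' * η) (𝓝 0) (𝓝 (K' * 0)) :=
      (continuous_const.mul continuous_id).tendsto 0
    rw [mul_zero] at this
    exact this.mono_left nhdsWithin_le_nhds
  have hpoly : Tendsto (fun η : ℝ => (doubleMoment N h h' 2 0 • (a 2 * b 0) +
      doubleMoment N h h' 1 1 • (a 1 * b 1) + doubleMoment N h h' 0 2 • (a 0 * b 2)) +
      (η • (doubleMoment N h h' 2 1 • (a 2 * b 1) + doubleMoment N h h' 1 2 • (a 1 * b 2)) +
      η ^ 2 • (doubleMoment N h h' 2 2 • (a 2 * b 2)))) (𝓝[>] 0)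
      (𝓝 (doubleMoment N h h' 2 0 • (a 2 * b 0) + doubleMoment N h h' 1 1 • (a 1 * b 1) +
        doubleMoment N h h' 0 2 • (a 0 * b 2))) := by
    refine Tendsto.mono_left ?_ nhdsWithin_le_nhds
    refine (Continuous.tendsto' (by fun_prop) _ _ ?_)
    simp
  have := hR0.add hpoly
  rw [zero_add] at this
  refine this.congr' ?_
  filter_upwards [hev] with η ⟨hη, _⟩
  simp only [hR, Finset.sum_range_succ, Finset.sum_range_zero, zero_add, hab]
  simp only [smul_zero, zero_add, smul_sub, smul_add, smul_smul]
  have i1 : ∀ d : ℝ, (η ^ 2)⁻¹ * (η * d) = η⁻¹ * d := fun d => by field_simp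
  have i2 : ∀ d : ℝ, (η ^ 2)⁻¹ * (η ^ 2 * d) = d := fun d => by field_simp
  have i3 : ∀ d : ℝ, (η ^ 2)⁻¹ * (η ^ 3 * d) = η * d := fun d => by field_simp
  have i4 : ∀ d : ℝ, (η ^ 2)⁻¹ * (η ^ 4 * d) = η ^ 2 * d := fun d => by field_simp
  norm_num [i1, i2, i3, i4]
  abel

end IteratedIntegral

end SympControl

/-! ### Leading order of the quadratic term along pairs of profiles. -/

namespace SympControl
open intervalIntegral Filter Topology

section PairAsymptotics
variable {𝔸 E ι : Type*} [NormedRing 𝔸] [NormedAlgebra ℝ 𝔸]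
  [NormedAddCommGroup E] [NormedSpace ℝ E]

/-- The matrix curve generated by the profiles `f`, `g` in the directions `i`, `l`, after
rescaling time by `η`. -/
def pairCurve (C : ι → ℝ → 𝔸) (f g : ℕ → ℝ → ℝ) (i l : ι) (η t : ℝ) : 𝔸 :=
  f 4 t • C i (η * t) + g 4 t • C l (η * t)

variable {p q N : ℕ} {f g f' g' : ℕ → ℝ → ℝ}

lemma continuous_pairCurve {C : ι → ℝ → 𝔸} (hC : ∀ i, Continuous (C i)) (hf : IsChain p f)
    (hg : IsChain q g) (i l : ι) (η : ℝ) : Continuous (pairCurve C f g i l η) := by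
  have := hf.continuous 4
  have := hg.continuous 4
  have := hC i
  have := hC l
  unfold pairCurve
  fun_prop

lemma iterInt_pairCurve {C : ι → ℝ → 𝔸} (hC : ∀ i, Continuous (C i)) (hf : IsChain p f)
    (hg : IsChain p g) (hf' : IsChain q f') (hg' : IsChain q g') (i l i' l' : ι) (η : ℝ) :
    iterInt N (pairCurve C f g i l η) (pairCurve C f' g' i' l' η) =
      iterInt N (fun t => f 4 t • C i (η * t)) (fun t => f' 4 t • C i' (η * t)) +
      iterInt N (fun t => f 4 t • C i (η * t)) (fun t => g' 4 t • C l' (η * t)) +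
      (iterInt N (fun t => g 4 t • C l (η * t)) (fun t => f' 4 t • C i' (η * t)) +
      iterInt N (fun t => g 4 t • C l (η * t)) (fun t => g' 4 t • C l' (η * t))) := by
  have := hf.continuous 4
  have := hg.continuous 4
  have := hf'.continuous 4
  have := hg'.continuous 4
  have := hC i
  have := hC l
  have := hC i'
  have := hC l'
  unfold pairCurve
  rw [iterInt_add_left N (by fun_prop) (by fun_prop) (by fun_prop),
    iterInt_add_right N (by fun_prop) (by fun_prop) (by fun_prop),
    iterInt_add_right N (by fun_prop) (by fun_prop) (by fun_prop)]

variable [CompleteSpace 𝔸] {T : ℝ} {C : ι → ℝ → 𝔸} {a : ι → ℕ → 𝔸} {K : ℝ}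

/-- Pairs of profiles in disjoint windows do not interact at the leading order. -/
lemma tendsto_iterInt_pairCurve_of_ne (hT : 0 < T) (hC : ∀ i, Continuous (C i))
    (ha : ∀ i, ∀ x ∈ Icc 0 T, ‖C i x - ∑ j ∈ Finset.range 3, x ^ j • a i j‖ ≤ K * x ^ 3)
    (h0 : ∀ i j, a i 0 * a j 0 = 0) (hf : IsChain p f) (hg : IsChain p g) (hf' : IsChain q f')
    (hg' : IsChain q g') (hpq : p ≠ q) (i l i' l' : ι) :
    Tendsto (fun η : ℝ => (η ^ 2)⁻¹ • iterInt N (pairCurve C f g i l η)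
      (pairCurve C f' g' i' l' η)) (𝓝[>] 0) (𝓝 0) := by
  have b1 := tendsto_iterInt_block (N := N) hT (hC i) (hC i') (ha i) (ha i') (h0 i i') hf hf'
  have b2 := tendsto_iterInt_block (N := N) hT (hC i) (hC l') (ha i) (ha l') (h0 i l') hf hg'
  have b3 := tendsto_iterInt_block (N := N) hT (hC l) (hC i') (ha l) (ha i') (h0 l i') hg hf'
  have b4 := tendsto_iterInt_block (N := N) hT (hC l) (hC l') (ha l) (ha l') (h0 l l') hg hg'
  simp only [doubleMoment_eq_zero hf hf' hpq, doubleMoment_eq_zero hf hg' hpq,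
    doubleMoment_eq_zero hg hf' hpq, doubleMoment_eq_zero hg hg' hpq, zero_smul, add_zero,
    smul_zero, sub_zero] at b1 b2 b3 b4
  simpa only [iterInt_pairCurve hC hf hg hf' hg', smul_add, add_zero] using
    (b1.add b2).add (b3.add b4)

/-- The leading order of the quadratic term along one pair of profiles. -/
lemma tendsto_iterInt_pairCurve_self (hT : 0 < T) (hC : ∀ i, Continuous (C i))
    (ha : ∀ i, ∀ x ∈ Icc 0 T, ‖C i x - ∑ j ∈ Finset.range 3, x ^ j • a i j‖ ≤ K * x ^ 3)
    (h0 : ∀ i j, a i 0 * a j 0 = 0) (h1 : ∀ i j, a i 1 * a j 0 + a i 0 * a j 1 = 0)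
    (h2 : ∀ i j, a i 2 * a j 0 + a i 1 * a j 1 + a i 0 * a j 2 = 0)
    {θ : 𝔸 →L[ℝ] E} (hθ1 : ∀ i, θ (a i 1 * a i 0 - a i 0 * a i 1) = 0)
    (hθ2 : ∀ i, θ (a i 2 * a i 0 - a i 0 * a i 2) = 0)
    (hf : IsChain p f) (hg : IsChain p g) (hp : p < N)
    (m1 : doubleMoment N f g 1 0 = doubleMoment N f g 0 1)
    (m2 : doubleMoment N f g 2 0 = doubleMoment N f g 0 2) (i l : ι) :
    Tendsto (fun η : ℝ => (η ^ 2)⁻¹ • θ (iterInt N (pairCurve C f g i l η)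
      (pairCurve C f g i l η))) (𝓝[>] 0)
      (𝓝 ((doubleMoment N f g 1 1 - doubleMoment N f g 0 2) •
        θ (a i 1 * a l 1 - a l 1 * a i 1))) := by
  have b1 := tendsto_iterInt_block (N := N) hT (hC i) (hC i) (ha i) (ha i) (h0 i i) hf hf
  have b2 := tendsto_iterInt_block (N := N) hT (hC i) (hC l) (ha i) (ha l) (h0 i l) hf hg
  have b3 := tendsto_iterInt_block (N := N) hT (hC l) (hC i) (ha l) (ha i) (h0 l i) hg hf
  have b4 := tendsto_iterInt_block (N := N) hT (hC l) (hC l) (ha l) (ha l) (h0 l l) hg hg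
  have self : ∀ {h : ℕ → ℝ → ℝ}, IsChain p h → doubleMoment N h h 0 1 = -doubleMoment N h h 1 0 ∧
      doubleMoment N h h 0 2 = -doubleMoment N h h 2 0 ∧ doubleMoment N h h 1 1 = 0 := by
    intro h hh
    refine ⟨doubleMoment_swap hh hh hp (by norm_num) (by norm_num),
      doubleMoment_swap hh hh hp (by norm_num) (by norm_num), ?_⟩
    have := doubleMoment_swap hh hh hp (a := 1) (b := 1) (by norm_num) (by norm_num)
    linarith
  have sw : ∀ {a b : ℕ}, a < 4 → b < 4 → doubleMoment N g f a b = -doubleMoment N f g b a :=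
    fun ha hb => doubleMoment_swap hg hf hp ha hb
  obtain ⟨f1, f2, f3⟩ := self hf
  obtain ⟨g1, g2, g3⟩ := self hg
  rw [f1, f2, f3] at b1
  rw [m1, m2] at b2
  rw [sw (a := 1) (b := 0) (by norm_num) (by norm_num), ← m1,
    sw (a := 0) (b := 1) (by norm_num) (by norm_num),
    sw (a := 2) (b := 0) (by norm_num) (by norm_num),
    sw (a := 0) (b := 2) (by norm_num) (by norm_num),
    sw (a := 1) (b := 1) (by norm_num) (by norm_num), m1, m2] at b3
  rw [g1, g2, g3] at b4
  have key := (θ.continuous.tendsto _).comp ((b1.add b2).add (b3.add b4))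
  have z1 : ∀ i, θ (a i 1 * a i 0) = θ (a i 0 * a i 1) := fun i =>
    sub_eq_zero.1 (by rw [← map_sub, hθ1])
  have z2 : ∀ i, θ (a i 2 * a i 0) = θ (a i 0 * a i 2) := fun i =>
    sub_eq_zero.1 (by rw [← map_sub, hθ2])
  have w1 : ∀ i j, θ (a i 1 * a j 0) = -θ (a i 0 * a j 1) := fun i j =>
    eq_neg_of_add_eq_zero_left (by rw [← map_add, h1, map_zero])
  have w2 : ∀ i j, θ (a i 1 * a j 1) = -(θ (a i 2 * a j 0) + θ (a i 0 * a j 2)) := fun i j =>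
    eq_neg_of_add_eq_zero_left (by
      rw [← map_add, ← map_add, ← map_zero θ, ← h2 i j]; congr 1; abel)
  convert key using 1
  -- The terms in η⁻¹ cancel: the diagonal blocks give commutators killed by θ, and the mixed ones
  -- give a_i1 a_l0 + a_i0 a_l1 and its counterpart with i, l exchanged, both zero by `h1`.
  · ext η
    rw [iterInt_pairCurve hC hf hg hf hg]
    simp only [Function.comp_apply, map_add, map_sub, map_smul, w1 i l, w1 l i, z1]
    module
  -- At second order the mixed terms a_i2 a_l0 + a_i0 a_l2 equal -a_i1 a_l1 by `h2`, so only the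
  -- commutator of a_i1 and a_l1 survives.
  · congr 1
    simp only [map_add, map_sub, map_smul, z2, w2 i l, w2 l i]
    module

end PairAsymptotics

end SympControl

/-! ### The linear term along oscillating profiles; control curves and Volterra operators. -/

namespace SympControl
open intervalIntegral Filter Topology

section Moments
variable {𝔸 : Type*} [NormedRing 𝔸] [NormedAlgebra ℝ 𝔸] [CompleteSpace 𝔸]
  {p N : ℕ} {h : ℕ → ℝ → ℝ}

/-- Oscillating profiles with vanishing moments integrate smooth curves to high order. -/
lemma tendsto_integral_smul_comp (hh : IsChain p h) (hp : p < N) {T : ℝ} (hT : 0 < T)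
    {C : ℝ → 𝔸} (hC : Continuous C) {a : ℕ → 𝔸} {K : ℝ}
    (ha : ∀ x ∈ Icc 0 T, ‖C x - ∑ i ∈ Finset.range 4, x ^ i • a i‖ ≤ K * x ^ 4) :
    Tendsto (fun η : ℝ => (η ^ 3)⁻¹ • ∫ t in (0 : ℝ)..N, h 4 t • C (η * t)) (𝓝[>] 0) (𝓝 0) := by
  have hc := hh.continuous 4
  obtain ⟨m, hm⟩ := isCompact_Icc.exists_bound_of_continuousOn
    (s := Icc (0 : ℝ) N) hc.continuousOn
  have pm : 0 ≤ m := (norm_nonneg _).trans (hm 0 ⟨le_rfl, N.cast_nonneg⟩)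
  have pK : 0 ≤ K := by
    have := (norm_nonneg _).trans (ha T ⟨hT.le, le_rfl⟩)
    exact nonneg_of_mul_nonneg_left this (by positivity)
  have hev : ∀ᶠ η : ℝ in 𝓝[>] 0, 0 < η ∧ η * N ≤ T := by
    have h1 : ∀ᶠ η : ℝ in 𝓝 0, η * N < T := by
      have : Tendsto (fun η : ℝ => η * N) (𝓝 0) (𝓝 (0 * N)) :=
        (continuous_id.mul continuous_const).tendsto 0
      rw [zero_mul] at this
      exact this.eventually (gt_mem_nhds hT)
    filter_upwards [self_mem_nhdsWithin, nhdsWithin_le_nhds h1] with η a b using ⟨a, b.le⟩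
  refine squeeze_zero_norm' (a := fun η => m * (K * N ^ 4) * N * η) ?_ ?_
  · filter_upwards [hev] with η ⟨hη, hηT⟩
    -- A fourth derivative with compact support is orthogonal to cubic polynomials, so only the
    -- Taylor remainder of order η⁴ contributes.
    have h0 : ∫ t in (0 : ℝ)..N, h 4 t • ∑ i ∈ Finset.range 4, (η * t) ^ i • a i = 0 := by
      rw [hh.integral_smul_sum le_rfl]
      exact Finset.sum_eq_zero fun i _ => by
        rw [hh.momentPrimitive_eq_zero i (notMem_Ioo_of_lt hp), mul_zero, zero_smul]
    have h1 : ∫ t in (0 : ℝ)..N, h 4 t • C (η * t) = ∫ t in (0 : ℝ)..N,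
        h 4 t • (C (η * t) - ∑ i ∈ Finset.range 4, (η * t) ^ i • a i) := by
      simp only [smul_sub]
      rw [intervalIntegral.integral_sub (Continuous.intervalIntegrable (by fun_prop) _ _)
        (Continuous.intervalIntegrable (by fun_prop) _ _), h0, sub_zero]
    rw [norm_smul, norm_inv, norm_pow, Real.norm_of_nonneg hη.le, inv_mul_le_iff₀ (by positivity),
      h1]
    refine (intervalIntegral.norm_integral_le_of_norm_le_const
      (C := m * (K * N ^ 4 * η ^ 4)) fun t ht => ?_).trans_eq ?_
    · rw [uIoc_of_le N.cast_nonneg] at ht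
      have ht1 := ht.1.le
      have ht2 := ht.2
      rw [norm_smul]
      refine mul_le_mul (hm t ⟨ht1, ht2⟩) ((ha _ ⟨by positivity,
        (mul_le_mul_of_nonneg_left ht2 hη.le).trans hηT⟩).trans ?_) (norm_nonneg _) pm
      calc K * (η * t) ^ 4 ≤ K * (η * N) ^ 4 := by gcongr
        _ = _ := by ring
    · rw [sub_zero, abs_of_nonneg N.cast_nonneg]
      ring
  · have : Tendsto (fun η : ℝ => m * (K * N ^ 4) * N * η) (𝓝 0)
        (𝓝 (m * (K * N ^ 4) * N * 0)) :=
      (continuous_const.mul continuous_id).tendsto 0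
    rw [mul_zero] at this
    exact this.mono_left nhdsWithin_le_nhds

end Moments

section ControlCurve
variable {𝔸 : Type*} [NormedRing 𝔸] [NormedAlgebra ℝ 𝔸] {T : ℝ} {k : ℕ}

/-- The curve `∑ i, u i • C i` attached to a continuous control `u`. -/
noncomputable def controlCurve (C : Fin k → C(Icc (0 : ℝ) T, 𝔸)) :
    (Fin k → C(Icc (0 : ℝ) T, ℝ)) →L[ℝ] C(Icc (0 : ℝ) T, 𝔸) :=
  ∑ i, ((ContinuousLinearMap.mul ℝ C(Icc (0 : ℝ) T, 𝔸)).flip (C i)).comp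
    (((Algebra.linearMap ℝ 𝔸).toContinuousLinearMap.compLeftContinuous ℝ
      (Icc (0 : ℝ) T)).comp (ContinuousLinearMap.proj i))

lemma controlCurve_apply (C : Fin k → C(Icc (0 : ℝ) T, 𝔸)) (u : Fin k → C(Icc (0 : ℝ) T, ℝ))
    (t : Icc (0 : ℝ) T) : controlCurve C u t = ∑ i, u i t • C i t := by
  simp only [controlCurve, sum_apply, ContinuousMap.coe_sum, Finset.sum_apply,
    Algebra.smul_def]
  rfl

/-- The control with profiles `f`, `g` at time scale `η` in the directions `i`, `l`. -/
noncomputable def pairControl (T : ℝ) (f g : C(ℝ, ℝ)) (i l : Fin k) (η : ℝ) : Fin k → C(Icc (0 : ℝ) T, ℝ) :=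
  Pi.single i ⟨fun t => f (t / η), by fun_prop⟩ + Pi.single l ⟨fun t => g (t / η), by fun_prop⟩

lemma extend_controlCurve_pairControl (hT : 0 ≤ T) (C : Fin k → C(Icc (0 : ℝ) T, 𝔸)) {p q : ℕ}
    {f g : ℕ → ℝ → ℝ} (hf : IsChain p f) (hg : IsChain q g) (i l : Fin k) {η : ℝ} (hη : 0 < η)
    {t : ℝ} (ht : t ∈ Icc 0 T) :
    extend hT (controlCurve C (pairControl T ⟨f 4, hf.continuous 4⟩ ⟨g 4, hg.continuous 4⟩ i l η))
      t = pairCurve (fun i => extend hT (C i)) f g i l η (t / η) := by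
  have hs : ∀ (j : Fin k) (F : C(Icc (0 : ℝ) T, ℝ)),
      controlCurve C (Pi.single j F) ⟨t, ht⟩ = F ⟨t, ht⟩ • C j ⟨t, ht⟩ := fun j F => by
    rw [controlCurve_apply, Finset.sum_eq_single j (fun i _ hi => by simp [Pi.single_eq_of_ne hi])
      (fun h => absurd (Finset.mem_univ j) h), Pi.single_eq_same]
  rw [extend_of_mem hT _ ht, pairControl, map_add, ContinuousMap.add_apply, hs, hs]
  simp only [pairCurve, mul_div_cancel₀ t hη.ne', extend_of_mem hT _ ht]
  rfl

lemma norm_pairControl_le {f g : C(ℝ, ℝ)} {m : ℝ} (hf : ∀ t, |f t| ≤ m) (hg : ∀ t, |g t| ≤ m)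
    (i l : Fin k) (η : ℝ) : ‖pairControl T f g i l η‖ ≤ m + m := by
  have hm : 0 ≤ m := (abs_nonneg _).trans (hf 0)
  refine (norm_add_le _ _).trans (add_le_add ?_ ?_)
  · rw [Pi.norm_single]
    exact (ContinuousMap.norm_le _ hm).2 fun t => hf _
  · rw [Pi.norm_single]
    exact (ContinuousMap.norm_le _ hm).2 fun t => hg _

lemma IsChain.exists_bound {p : ℕ} {h : ℕ → ℝ → ℝ} (hh : IsChain p h) (j : ℕ) :
    ∃ m, ∀ t, |h j t| ≤ m := by
  obtain ⟨m, hm⟩ := (isCompact_Icc (a := (p : ℝ)) (b := p + 1)).exists_bound_of_continuousOn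
    (hh.continuous j).continuousOn
  refine ⟨m, fun t => ?_⟩
  by_cases ht : t ∈ Ioo (p : ℝ) (p + 1)
  · exact hm t (Ioo_subset_Icc_self ht)
  · rw [hh.zero j t ht, abs_zero]
    exact (norm_nonneg _).trans (hm p ⟨le_rfl, by linarith⟩)

variable [CompleteSpace 𝔸]

lemma volterra_one_apply (hT : 0 ≤ T) (M : C(Icc (0 : ℝ) T, 𝔸)) (t : Icc (0 : ℝ) T) :
    volterra hT M 1 t = ∫ s in (0 : ℝ)..t, extend hT M s := by
  rw [volterra_apply]
  refine integral_congr fun s _ => ?_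
  change extend hT M s * 1 = _
  rw [mul_one]

lemma volterra_volterra_one_apply (hT : 0 ≤ T) (M M' : C(Icc (0 : ℝ) T, 𝔸)) :
    volterra hT M (volterra hT M' 1) ⟨T, hT, le_rfl⟩ =
      iterInt T (extend hT M) (extend hT M') := by
  rw [volterra_apply, iterInt]
  refine integral_congr fun s hs => ?_
  rw [uIcc_of_le hT] at hs
  rw [extend_of_mem hT (volterra hT M' 1) hs, volterra_one_apply]

end ControlCurve

end SympControl

/-! ### A regular zero of the second order expansion of the end-point map. -/

namespace SympControl
open intervalIntegral Filter Topology

section RegularControl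
variable {𝔸 G : Type*} [NormedRing 𝔸] [NormedAlgebra ℝ 𝔸]
  [NormedAddCommGroup G] [NormedSpace ℝ G] {T : ℝ} {k : ℕ}

/-- The end value of a curve, followed by a linear map. -/
noncomputable def endValue (hT : 0 ≤ T) (L : 𝔸 →L[ℝ] G) : C(Icc (0 : ℝ) T, 𝔸) →L[ℝ] G :=
  L.comp (ContinuousMap.evalCLM ℝ ⟨T, hT, le_rfl⟩)

lemma endValue_apply (hT : 0 ≤ T) (L : 𝔸 →L[ℝ] G) (Y : C(Icc (0 : ℝ) T, 𝔸)) :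
    endValue hT L Y = L (Y ⟨T, hT, le_rfl⟩) := rfl

variable [CompleteSpace 𝔸]

/-- The operator `Y ↦ ∫ M Y` for the curve `M` generated by a control. -/
noncomputable def controlOp (hT : 0 ≤ T) (C : Fin k → C(Icc (0 : ℝ) T, 𝔸)) :
    (Fin k → C(Icc (0 : ℝ) T, ℝ)) →L[ℝ] C(Icc (0 : ℝ) T, 𝔸) →L[ℝ] C(Icc (0 : ℝ) T, 𝔸) :=
  (volterra hT).comp (controlCurve C)

/-- Coordinates on the quotient G ⧸ V, used to compute modulo the range of the linear term. -/
lemma exists_surjective_ker_eq [FiniteDimensional ℝ G] (V : Submodule ℝ G) :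
    ∃ (d : ℕ) (π : G →L[ℝ] (Fin d → ℝ)), Function.Surjective π ∧ ∀ y, π y = 0 ↔ y ∈ V := by
  let b := Module.finBasis ℝ (G ⧸ V)
  refine ⟨_, (b.equivFun.toLinearMap ∘ₗ V.mkQ).toContinuousLinearMap, ?_, fun y => ?_⟩
  · exact b.equivFun.surjective.comp V.mkQ_surjective
  · change b.equivFun (V.mkQ y) = 0 ↔ _
    rw [LinearEquiv.map_eq_zero_iff, Submodule.mkQ_apply, Submodule.Quotient.mk_eq_zero]

/-- A continuous right inverse on the range of L, which may be a proper subspace; continuity is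
automatic since R starts from a finite-dimensional space. It serves to correct controls into the
kernel of L. -/
lemma exists_rightInverse_on [FiniteDimensional ℝ G] {U : Type*} [NormedAddCommGroup U]
    [NormedSpace ℝ U] (L : U →L[ℝ] G) : ∃ R : G →L[ℝ] U, ∀ u, L (R (L u)) = L u := by
  obtain ⟨r, hr⟩ := LinearMap.exists_rightInverse_of_surjective
    (L : U →ₗ[ℝ] G).rangeRestrict (LinearMap.range_rangeRestrict _)
  obtain ⟨s, hs⟩ := LinearMap.exists_leftInverse_of_injective
    (LinearMap.range (L : U →ₗ[ℝ] G)).subtype (Submodule.ker_subtype _)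
  refine ⟨(r ∘ₗ s).toContinuousLinearMap, fun u => ?_⟩
  have h1 : s (L u) = (L : U →ₗ[ℝ] G).rangeRestrict u :=
    LinearMap.congr_fun hs ((L : U →ₗ[ℝ] G).rangeRestrict u)
  change L (r (s (L u))) = L u
  rw [h1]
  exact congrArg Subtype.val (LinearMap.congr_fun hr ((L : U →ₗ[ℝ] G).rangeRestrict u))

/-- Corrections that are o(1/c) do not change the limit of the form scaled by c, as long as the
arguments stay bounded. -/
lemma tendsto_bilinear_sub {U X : Type*} [NormedAddCommGroup U] [NormedSpace ℝ U]
    (b : U →L[ℝ] U →L[ℝ] G) {x y r s : X → U} {c : X → ℝ} {l : Filter X} {m m' : ℝ}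
    (hx : ∀ η, ‖x η‖ ≤ m) (hy : ∀ η, ‖y η‖ ≤ m') (hr : Tendsto (fun η => c η • r η) l (𝓝 0))
    (hr' : Tendsto r l (𝓝 0)) (hs : Tendsto (fun η => c η • s η) l (𝓝 0)) :
    Tendsto (fun η => c η • b (x η - r η) (y η - s η) - c η • b (x η) (y η)) l (𝓝 0) := by
  have s1 : Tendsto (fun η => b (x η) (c η • s η)) l (𝓝 0) := by
    refine squeeze_zero_norm (a := fun η => ‖b‖ * m * ‖c η • s η‖)
      (fun η => (b.le_opNorm₂ _ _).trans ?_) ?_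
    · gcongr
      exact hx η
    · simpa using hs.norm.const_mul (‖b‖ * m)
  have s2 : Tendsto (fun η => b (c η • r η) (y η)) l (𝓝 0) := by
    refine squeeze_zero_norm (a := fun η => ‖b‖ * ‖c η • r η‖ * m')
      (fun η => (b.le_opNorm₂ _ _).trans ?_) ?_
    · gcongr
      exact hy η
    · simpa using (hr.norm.const_mul ‖b‖).mul_const m'
  have s3 : Tendsto (fun η => b (r η) (c η • s η)) l (𝓝 0) := by
    have := (b.continuous₂.tendsto (0, 0)).comp (hr'.prodMk_nhds hs)
    simpa only [Function.uncurry, Function.comp_def, map_zero] using this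
  have := (s3.sub s1).sub s2
  rw [sub_zero, sub_zero] at this
  refine this.congr fun η => ?_
  simp only [map_sub, map_smul, sub_apply, FunLike.coe_smul, Pi.smul_apply]
  module

variable {C : Fin k → C(Icc (0 : ℝ) T, 𝔸)} {p q N : ℕ} {f g f' g' : ℕ → ℝ → ℝ}

lemma endValue_pairControl (hT : 0 ≤ T) (L : 𝔸 →L[ℝ] G) (hf : IsChain p f) (hg : IsChain p g)
    (hp : p < N) (i l : Fin k) {η : ℝ} (hη : 0 < η) (hηT : η * N ≤ T) :
    endValue hT L (controlOp hT C
      (pairControl T ⟨f 4, hf.continuous 4⟩ ⟨g 4, hg.continuous 4⟩ i l η) 1) =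
      η • L (∫ t in (0 : ℝ)..N, pairCurve (fun i => extend hT (C i)) f g i l η t) := by
  have hc := continuous_pairCurve (fun i => continuous_extend hT (C i)) hf hg i l η
  rw [endValue_apply, ← map_smul, ← integral_scale hη hηT hc]
  · congr 1
    refine (volterra_one_apply hT _ _).trans (integral_congr fun t ht => ?_)
    rw [uIcc_of_le hT] at ht
    exact extend_controlCurve_pairControl hT C hf hg i l hη ht
  · intro t ht
    have : t ∉ Ioo (p : ℝ) (p + 1) := fun h => absurd (h.2.trans_le
      ((by exact_mod_cast hp : (p : ℝ) + 1 ≤ N).trans ht)) (lt_irrefl _)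
    simp [pairCurve, hf.zero 4 t this, hg.zero 4 t this]

lemma endValue_pairControl_pairControl (hT : 0 ≤ T) (L : 𝔸 →L[ℝ] G) (hf : IsChain p f)
    (hg : IsChain p g) (hf' : IsChain q f') (hg' : IsChain q g') (hp : p < N) (i l i' l' : Fin k)
    {η : ℝ} (hη : 0 < η) (hηT : η * N ≤ T) :
    endValue hT L (controlOp hT C
      (pairControl T ⟨f 4, hf.continuous 4⟩ ⟨g 4, hg.continuous 4⟩ i l η) (controlOp hT C
      (pairControl T ⟨f' 4, hf'.continuous 4⟩ ⟨g' 4, hg'.continuous 4⟩ i' l' η) 1)) =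
      η ^ 2 • L (iterInt N (pairCurve (fun i => extend hT (C i)) f g i l η)
        (pairCurve (fun i => extend hT (C i)) f' g' i' l' η)) := by
  have hc := continuous_pairCurve (fun i => continuous_extend hT (C i)) hf hg i l η
  have hc' := continuous_pairCurve (fun i => continuous_extend hT (C i)) hf' hg' i' l' η
  rw [endValue_apply, ← map_smul, ← iterInt_scale hη hηT hc hc']
  · congr 1
    refine (volterra_volterra_one_apply hT _ _).trans (integral_congr fun t ht => ?_)
    rw [uIcc_of_le hT] at ht
    have : ∫ s in (0 : ℝ)..t, extend hT (controlCurve C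
        (pairControl T ⟨f' 4, hf'.continuous 4⟩ ⟨g' 4, hg'.continuous 4⟩ i' l' η)) s =
        ∫ s in (0 : ℝ)..t, pairCurve (fun i => extend hT (C i)) f' g' i' l' η (s / η) :=
      integral_congr fun s hs => by
        rw [uIcc_of_le ht.1] at hs
        exact extend_controlCurve_pairControl hT C hf' hg' i' l' hη ⟨hs.1, hs.2.trans ht.2⟩
    exact congrArg₂ (· * ·) (extend_controlCurve_pairControl hT C hf hg i l hη ht) this
  · intro t ht
    have : t ∉ Ioo (p : ℝ) (p + 1) := fun h => absurd (h.2.trans_le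
      ((by exact_mod_cast hp : (p : ℝ) + 1 ≤ N).trans ht)) (lt_irrefl _)
    simp [pairCurve, hf.zero 4 t this, hg.zero 4 t this]

/-- Existence of a regular zero of the second order expansion of the end-point map. -/
lemma exists_regular_control [FiniteDimensional ℝ G] (hT : 0 < T) (C : Fin k → C(Icc (0 : ℝ) T, 𝔸))
    (L : 𝔸 →L[ℝ] G) {a : Fin k → ℕ → 𝔸} {K : ℝ}
    (ha3 : ∀ i, ∀ x ∈ Icc 0 T,
      ‖extend hT.le (C i) x - ∑ j ∈ Finset.range 3, x ^ j • a i j‖ ≤ K * x ^ 3)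
    (ha4 : ∀ i, ∀ x ∈ Icc 0 T,
      ‖extend hT.le (C i) x - ∑ j ∈ Finset.range 4, x ^ j • a i j‖ ≤ K * x ^ 4)
    (h0 : ∀ i j, a i 0 * a j 0 = 0) (h1 : ∀ i j, a i 1 * a j 0 + a i 0 * a j 1 = 0)
    (h2 : ∀ i j, a i 2 * a j 0 + a i 1 * a j 1 + a i 0 * a j 2 = 0)
    {V : Submodule ℝ G}
    (hV : ∀ y, y ∈ V ↔ ∃ u, endValue hT.le L (controlOp hT.le C u 1) = y)
    (hV1 : ∀ i, L (a i 1 * a i 0 - a i 0 * a i 1) ∈ V)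
    (hV2 : ∀ i, L (a i 2 * a i 0 - a i 0 * a i 2) ∈ V)
    (hspan : V ⊔ Submodule.span ℝ
      (range fun p : Fin k × Fin k => L (a p.1 1 * a p.2 1 - a p.2 1 * a p.1 1)) = ⊤) :
    ∃ w z₀, endValue hT.le L (controlOp hT.le C w 1) = 0 ∧
      endValue hT.le L (controlOp hT.le C z₀ 1) +
        endValue hT.le L (controlOp hT.le C w (controlOp hT.le C w 1)) = 0 ∧
      ∀ y, ∃ z v, endValue hT.le L (controlOp hT.le C v 1) = 0 ∧
        endValue hT.le L (controlOp hT.le C z 1) +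
          (endValue hT.le L (controlOp hT.le C w (controlOp hT.le C v 1)) +
            endValue hT.le L (controlOp hT.le C v (controlOp hT.le C w 1))) = y := by
  set Op := controlOp hT.le C
  set φ := endValue hT.le L
  let Lin : (Fin k → C(Icc (0 : ℝ) T, ℝ)) →L[ℝ] G := φ.comp (Op.flip 1)
  obtain ⟨R, hR⟩ := exists_rightInverse_on Lin
  obtain ⟨d, π, hπ, hker⟩ := exists_surjective_ker_eq V
  obtain ⟨c, hc, hprof⟩ := exists_profiles
  let ι := Fin k × Fin k
  -- Each ordered pair of indices receives its own unit window, so that distinct pairs do not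
  -- interact at leading order.
  let n : ι → ℕ := fun p => Fintype.equivFin ι p
  let N := Fintype.card ι
  have hn : ∀ p, n p < N := fun p => (Fintype.equivFin ι p).2
  have hninj : ∀ p q, p ≠ q → n p ≠ n q := fun p q hpq h =>
    hpq ((Fintype.equivFin ι).injective (Fin.ext h))
  choose f g hf hg hm using fun p : ι => hprof (n p)
  let W : ℝ → ι → (Fin k → C(Icc (0 : ℝ) T, ℝ)) := fun η p =>
    pairControl T ⟨f p 4, (hf p).continuous 4⟩ ⟨g p 4, (hg p).continuous 4⟩ p.1 p.2 η
  have hev : ∀ᶠ η : ℝ in 𝓝[>] 0, 0 < η ∧ η * N ≤ T := by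
    have h1 : ∀ᶠ η : ℝ in 𝓝 0, η * N < T := by
      have : Tendsto (fun η : ℝ => η * N) (𝓝 0) (𝓝 (0 * N)) :=
        (continuous_id.mul continuous_const).tendsto 0
      rw [zero_mul] at this
      exact this.eventually (gt_mem_nhds hT)
    filter_upwards [self_mem_nhdsWithin, nhdsWithin_le_nhds h1] with η a b using ⟨a, b.le⟩
  have hcont : ∀ i, Continuous (extend hT.le (C i)) := fun i => continuous_extend hT.le (C i)
  -- the linear part of the oscillating controls is of higher order
  have hLin : ∀ p, Tendsto (fun η => (η ^ 4)⁻¹ • Lin (W η p)) (𝓝[>] 0) (𝓝 0) := by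
    intro p
    have t1 := tendsto_integral_smul_comp (hf p) (hn p) hT (hcont p.1) (ha4 p.1)
    have t2 := tendsto_integral_smul_comp (hg p) (hn p) hT (hcont p.2) (ha4 p.2)
    have t3 := (L.continuous.tendsto _).comp (t1.add t2)
    rw [add_zero, map_zero] at t3
    refine t3.congr' ?_
    filter_upwards [hev] with η ⟨hη, hηT⟩
    have e : Lin (W η p) = _ :=
      endValue_pairControl hT.le L (hf p) (hg p) (hn p) p.1 p.2 hη hηT
    have := (hf p).continuous 4
    have := (hg p).continuous 4
    have := hcont p.1
    have := hcont p.2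
    rw [e, smul_smul]
    simp only [pairCurve, Function.comp_apply]
    rw [intervalIntegral.integral_add (Continuous.intervalIntegrable (by fun_prop) _ _)
      (Continuous.intervalIntegrable (by fun_prop) _ _), ← smul_add, map_smul]
    congr 1
    field_simp
  have hbdd : ∀ p, ∃ m, ∀ η, ‖W η p‖ ≤ m := fun p => by
    obtain ⟨m₁, hm₁⟩ := (hf p).exists_bound 4
    obtain ⟨m₂, hm₂⟩ := (hg p).exists_bound 4
    exact ⟨_, fun η => norm_pairControl_le (m := max m₁ m₂)
      (fun t => (hm₁ t).trans (le_max_left _ _)) (fun t => (hm₂ t).trans (le_max_right _ _))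
      _ _ η⟩
  choose m hmW using hbdd
  let b : (Fin k → C(Icc (0 : ℝ) T, ℝ)) →L[ℝ] (Fin k → C(Icc (0 : ℝ) T, ℝ)) →L[ℝ] G :=
    (ContinuousLinearMap.compL ℝ _ _ _ φ).comp
      (((ContinuousLinearMap.compL ℝ _ _ _).flip (Op.flip 1)).comp Op)
  have hb : ∀ u v, φ (Op u (Op v 1)) = b u v := fun u v => rfl
  -- the corrected controls, in the kernel of the linear part
  let W' : ℝ → ι → (Fin k → C(Icc (0 : ℝ) T, ℝ)) := fun η p => W η p - R (Lin (W η p))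
  have hW' : ∀ η p, Lin (W' η p) = 0 := fun η p => by
    simp only [W', map_sub, hR, sub_self]
  have hRl : ∀ p, Tendsto (fun η => (η ^ 4)⁻¹ • R (Lin (W η p))) (𝓝[>] 0) (𝓝 0) := fun p => by
    have := (R.continuous.tendsto _).comp (hLin p)
    rw [map_zero] at this
    exact this.congr fun η => R.map_smul _ _
  have hRl' : ∀ p, Tendsto (fun η => R (Lin (W η p))) (𝓝[>] 0) (𝓝 0) := fun p => by
    have h4 : Tendsto (fun η : ℝ => η ^ 4) (𝓝[>] 0) (𝓝 0) :=
      ((continuous_pow 4).tendsto' 0 0 (by norm_num)).mono_left nhdsWithin_le_nhds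
    have := h4.smul (hRl p)
    rw [smul_zero] at this
    refine this.congr' ?_
    filter_upwards [hev] with η ⟨hη, _⟩
    rw [smul_inv_smul₀ (by positivity)]
  have hlimb : ∀ p q, Tendsto (fun η => (η ^ 4)⁻¹ • b (W' η p) (W' η q) -
      (η ^ 4)⁻¹ • b (W η p) (W η q)) (𝓝[>] 0) (𝓝 0) := by
    intro p q
    exact tendsto_bilinear_sub b (hmW p) (hmW q) (hRl p) (hRl' p) (hRl q)
  let e : ι → (Fin d → ℝ) := fun p => c • π (L (a p.1 1 * a p.2 1 - a p.2 1 * a p.1 1))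
  have hθ : ∀ x, L x ∈ V → (π.comp L) x = 0 := fun x hx => (hker _).2 hx
  have hβ : ∀ p q, Tendsto (fun η => (η ^ 4)⁻¹ • π (b (W' η p) (W' η q))) (𝓝[>] 0)
      (𝓝 (if p = q then e p else 0)) := by
    intro p q
    have key : Tendsto (fun η => (η ^ 4)⁻¹ • π (b (W η p) (W η q))) (𝓝[>] 0)
        (𝓝 (if p = q then e p else 0)) := by
      have step : ∀ᶠ η in 𝓝[>] (0 : ℝ), (η ^ 2)⁻¹ • (π.comp L) (iterInt N
          (pairCurve (fun i => extend hT.le (C i)) (f p) (g p) p.1 p.2 η)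
          (pairCurve (fun i => extend hT.le (C i)) (f q) (g q) q.1 q.2 η)) =
          (η ^ 4)⁻¹ • π (b (W η p) (W η q)) := by
        filter_upwards [hev] with η ⟨hη, hηT⟩
        have e1 : b (W η p) (W η q) = _ := endValue_pairControl_pairControl hT.le L (hf p) (hg p)
          (hf q) (hg q) (hn p) p.1 p.2 q.1 q.2 hη hηT
        rw [e1, map_smul, smul_smul]
        change _ • π (L _) = _
        congr 1
        field_simp
      refine Tendsto.congr' step ?_
      by_cases hpq : p = q
      · subst hpq
        rw [if_pos rfl]
        obtain ⟨m1, m2, m3⟩ := hm p N (hn p)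
        have := tendsto_iterInt_pairCurve_self hT hcont ha3 h0 h1 h2 (fun i => hθ _ (hV1 i))
          (fun i => hθ _ (hV2 i)) (hf p) (hg p) (hn p) m1 m2 p.1 p.2
        rw [m3] at this
        exact this
      · rw [if_neg hpq]
        have := tendsto_iterInt_pairCurve_of_ne (N := N) hT hcont ha3 h0 (hf p) (hg p) (hf q)
          (hg q) (hninj p q hpq) p.1 p.2 q.1 q.2
        have := ((π.comp L).continuous.tendsto _).comp this
        rw [map_zero] at this
        exact this.congr fun η => (π.comp L).map_smul _ _
    have := key.add ((π.continuous.tendsto _).comp (hlimb p q))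
    rw [map_zero, add_zero] at this
    refine this.congr fun η => ?_
    simp only [Function.comp_apply, map_sub, map_smul]
    abel
  -- Exchanging the two indices of a pair changes the sign of its commutator; this is why all
  -- ordered pairs are used.
  have hesum : ∑ p, e p = 0 := by
    have hsw : ∑ p, e p = ∑ p : ι, -e p := by
      rw [← (Equiv.prodComm (Fin k) (Fin k)).sum_comp]
      refine Finset.sum_congr rfl fun p _ => ?_
      simp only [e, Equiv.prodComm_apply, Prod.fst_swap, Prod.snd_swap]
      rw [← smul_neg, ← map_neg, ← map_neg, neg_sub]
    rw [Finset.sum_neg_distrib] at hsw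
    exact self_eq_neg.1 hsw
  have hespan : Submodule.span ℝ (range e) = ⊤ := by
    have hr : range e = π ''
        (range fun p : ι => c • L (a p.1 1 * a p.2 1 - a p.2 1 * a p.1 1)) := by
      rw [← range_comp]
      exact congrArg range (funext fun p => (π.map_smul _ _).symm)
    have hle : ⊤ ≤ V ⊔ Submodule.span ℝ
        (range fun p : ι => c • L (a p.1 1 * a p.2 1 - a p.2 1 * a p.1 1)) := by
      rw [← hspan]
      refine sup_le_sup_left (Submodule.span_le.2 ?_) V
      rintro _ ⟨p, rfl⟩
      have : L (a p.1 1 * a p.2 1 - a p.2 1 * a p.1 1) =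
          c⁻¹ • (c • L (a p.1 1 * a p.2 1 - a p.2 1 * a p.1 1)) := by
        rw [inv_smul_smul₀ hc.ne']
      beta_reduce
      rw [this]
      exact Submodule.smul_mem _ _ (Submodule.subset_span ⟨p, rfl⟩)
    rw [eq_top_iff]
    intro y _
    obtain ⟨x, rfl⟩ := hπ y
    obtain ⟨v, hv, s, hs, rfl⟩ := Submodule.mem_sup.1 (hle (Submodule.mem_top : x ∈ ⊤))
    rw [map_add, (hker v).2 hv, zero_add, hr]
    have := Submodule.mem_map_of_mem (f := (π : G →ₗ[ℝ] (Fin d → ℝ))) hs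
    rwa [Submodule.map_span] at this
  obtain ⟨η, ⟨α, hα0, hα1⟩, hη, -⟩ :=
    ((eventually_exists_regular_zero hβ hesum hespan).and hev).exists
  have hη4 : (η ^ 4)⁻¹ ≠ 0 := by positivity
  have hcombo : ∀ x : ι → ℝ, φ (Op (∑ p, x p • W' η p) 1) = 0 := fun x => by
    change Lin _ = 0
    rw [map_sum]
    exact Finset.sum_eq_zero fun p _ => by rw [map_smul, hW', smul_zero]
  have hbil : ∀ x y : ι → ℝ, (η ^ 4)⁻¹ • π (b (∑ p, x p • W' η p) (∑ p, y p • W' η p)) =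
      ∑ p, ∑ q, (x p * y q) • (η ^ 4)⁻¹ • π (b (W' η p) (W' η q)) := fun x y => by
    simp only [map_sum, sum_apply, map_smul, FunLike.coe_smul, Pi.smul_apply, Finset.smul_sum]
    rw [Finset.sum_comm]
    refine Finset.sum_congr rfl fun p _ => Finset.sum_congr rfl fun q _ => ?_
    simp only [smul_smul]
    congr 1
    ring
  set w := ∑ p, α p • W' η p with hw
  -- The zero is found only modulo V. Since V is the range of the linear term, z₀ cancels what
  -- remains, and z below plays the same role for the derivative.
  have hww : b w w ∈ V := by
    rw [← hker, ← smul_eq_zero_iff_right hη4, hw, hbil, hα0]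
  obtain ⟨z₀, hz₀⟩ := (hV _).1 (V.neg_mem hww)
  refine ⟨w, z₀, hcombo α, ?_, fun y => ?_⟩
  · rw [hz₀, hb, neg_add_cancel]
  · obtain ⟨ν, hν⟩ := hα1 ((η ^ 4)⁻¹ • π y)
    set v := ∑ p, ν p • W' η p with hv
    have hmem : y - (b w v + b v w) ∈ V := by
      rw [← hker, map_sub, map_add, sub_eq_zero]
      refine smul_right_injective _ hη4 ?_
      beta_reduce
      rw [smul_add, hw, hv, hbil, hbil, ← hν, ← Finset.sum_add_distrib]
      refine Finset.sum_congr rfl fun p _ => ?_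
      rw [← Finset.sum_add_distrib]
      refine Finset.sum_congr rfl fun q _ => ?_
      rw [← add_smul]
    obtain ⟨z, hz⟩ := (hV _).1 hmem
    exact ⟨z, v, hcombo ν, by rw [hz, hb, hb, sub_add_cancel]⟩

end RegularControl

end SympControl

/-! ### The symplectic group, its Lie algebra, and a linear chart near the identity. -/

namespace SympControl
open intervalIntegral Filter Topology Matrix

section Symplectic
variable {m : ℕ}

lemma mem_spTangent_iff {Y : Mat m} : Y ∈ spTangent m ↔ Yᵀ * J (Fin m) ℝ = -(J (Fin m) ℝ * Y) := by
  change (J (Fin m) ℝ * Y)ᵀ = _ ↔ _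
  rw [Matrix.transpose_mul, J_transpose, Matrix.mul_neg, neg_eq_iff_eq_neg]

lemma mem_Sp_iff {Y : Mat m} : Y ∈ Sp m ↔ Yᵀ * J (Fin m) ℝ * Y = J (Fin m) ℝ :=
  SymplecticGroup.mem_iff'

lemma mul_mem_Sp {X Y : Mat m} (hX : X ∈ Sp m) (hY : Y ∈ Sp m) : X * Y ∈ Sp m :=
  (symplecticGroup (Fin m) ℝ).mul_mem hX hY

lemma one_mem_Sp : (1 : Mat m) ∈ Sp m := (symplecticGroup (Fin m) ℝ).one_mem

/-- The inverse of a symplectic matrix. -/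
noncomputable def sympInv (Y : Mat m) : Mat m := -(J (Fin m) ℝ * Yᵀ * J (Fin m) ℝ)

lemma sympInv_mem_Sp {Y : Mat m} (hY : Y ∈ Sp m) : sympInv Y ∈ Sp m :=
  SymplecticGroup.neg_mem (mul_mem_Sp (mul_mem_Sp (SymplecticGroup.J_mem _ _)
    (SymplecticGroup.transpose_mem hY)) (SymplecticGroup.J_mem _ _))

lemma sympInv_mul {Y : Mat m} (hY : Y ∈ Sp m) : sympInv Y * Y = 1 := by
  rw [sympInv, Matrix.neg_mul]
  exact SymplecticGroup.inv_left_mul_aux hY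

lemma mul_sympInv {Y : Mat m} (hY : Y ∈ Sp m) : Y * sympInv Y = 1 :=
  mul_eq_one_comm.1 (sympInv_mul hY)

/-- From J · `sympInv S` = Sᵀ J, multiplying the conjugate by J gives Sᵀ (J Y) S, a congruence of a
symmetric matrix. -/
lemma sympInv_conj_mem {S Y : Mat m} (hY : Y ∈ spTangent m) :
    sympInv S * Y * S ∈ spTangent m := by
  have hJ := J_squared (Fin m) ℝ
  change (J (Fin m) ℝ * (sympInv S * Y * S)).IsSymm
  have h1 : J (Fin m) ℝ * (sympInv S * Y * S) = Sᵀ * (J (Fin m) ℝ * Y) * S := by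
    have : J (Fin m) ℝ * sympInv S = Sᵀ * J (Fin m) ℝ := by
      rw [sympInv, Matrix.mul_neg, ← Matrix.mul_assoc, ← Matrix.mul_assoc, hJ]
      simp
    rw [← Matrix.mul_assoc, ← Matrix.mul_assoc, this]
    simp only [Matrix.mul_assoc]
  rw [h1]
  have h2 : (J (Fin m) ℝ * Y)ᵀ = J (Fin m) ℝ * Y := hY
  change (Sᵀ * (J (Fin m) ℝ * Y) * S)ᵀ = _
  rw [Matrix.transpose_mul, Matrix.transpose_mul, h2, Matrix.transpose_transpose, Matrix.mul_assoc Sᵀ]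

lemma hasDerivAt_transpose {W : ℝ → Mat m} {W' : Mat m} {t : ℝ} (h : HasDerivAt W W' t) :
    HasDerivAt (fun t => (W t)ᵀ) W'ᵀ t :=
  (LinearMap.toContinuousLinearMap
    (Matrix.transposeLinearEquiv (Fin m ⊕ Fin m) (Fin m ⊕ Fin m) ℝ ℝ).toLinearMap).hasFDerivAt
      |>.comp_hasDerivAt t h

/-- The form WᵀJW is conserved: its derivative is Wᵀ(MᵀJ + JM)W = 0. -/
lemma mem_Sp_of_hasDerivAt {T : ℝ} {W M : ℝ → Mat m}
    (hW : ∀ t ∈ Icc 0 T, HasDerivAt W (M t * W t) t) (hM : ∀ t ∈ Icc 0 T, M t ∈ spTangent m)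
    (h0 : W 0 ∈ Sp m) {t : ℝ} (ht : t ∈ Icc 0 T) : W t ∈ Sp m := by
  have hd : ∀ t ∈ Icc 0 T, HasDerivAt (fun t => (W t)ᵀ * J (Fin m) ℝ * W t) 0 t := fun t ht => by
    refine (((hasDerivAt_transpose (hW t ht)).mul_const (J (Fin m) ℝ)).mul (hW t ht)).congr_deriv ?_
    have := mem_spTangent_iff.1 (hM t ht)
    rw [Matrix.transpose_mul, Matrix.mul_assoc _ (M t)ᵀ, this]
    simp only [Matrix.mul_neg, Matrix.neg_mul, Matrix.mul_assoc, neg_add_cancel]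
  have := constant_of_has_deriv_right_zero
    (fun t ht => (hd t ht).continuousAt.continuousWithinAt)
    (fun t ht => (hd t (Ico_subset_Icc_self ht)).hasDerivWithinAt) t ht
  rw [mem_Sp_iff] at h0 ⊢
  exact this.trans h0

lemma hasDerivAt_sympInv {S A : ℝ → Mat m} {t : ℝ} (hS : HasDerivAt S (A t * S t) t)
    (hA : A t ∈ spTangent m) :
    HasDerivAt (fun t => sympInv (S t)) (-(sympInv (S t) * A t)) t := by
  refine ((((hasDerivAt_transpose hS).const_mul (J (Fin m) ℝ)).mul_const
    (J (Fin m) ℝ)).neg).congr_deriv ?_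
  have := mem_spTangent_iff.1 hA
  rw [sympInv, Matrix.transpose_mul, Matrix.neg_mul]
  congr 1
  simp only [Matrix.mul_assoc, this, Matrix.mul_neg]

/-- The projection of matrices onto the Lie algebra of the symplectic group. -/
noncomputable def spProj (m : ℕ) : Mat m →L[ℝ] spTangent m :=
  LinearMap.toContinuousLinearMap
    { toFun := fun x => ⟨(1 / 2 : ℝ) • (x + J (Fin m) ℝ * xᵀ * J (Fin m) ℝ), by
        rw [mem_spTangent_iff]
        have hJ := J_squared (Fin m) ℝ
        have e1 : J (Fin m) ℝ * xᵀ * J (Fin m) ℝ = J (Fin m) ℝ * (xᵀ * J (Fin m) ℝ) :=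
          Matrix.mul_assoc _ _ _
        simp only [Matrix.transpose_smul, Matrix.transpose_add, Matrix.transpose_mul, J_transpose,
          Matrix.transpose_transpose, Matrix.smul_mul, Matrix.mul_smul, Matrix.mul_add,
          Matrix.add_mul, Matrix.neg_mul, Matrix.mul_neg, neg_neg, Matrix.mul_assoc, hJ,
          Matrix.mul_one]
        rw [← Matrix.mul_assoc, hJ]
        simp only [Matrix.neg_mul, Matrix.one_mul]
        rw [← smul_neg]
        congr 1
        abel⟩
      map_add' := fun x y => by
        ext1
        simp only [Matrix.transpose_add, Matrix.mul_add, Matrix.add_mul, Submodule.coe_add]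
        module
      map_smul' := fun c x => by
        ext1
        simp only [Matrix.transpose_smul, Matrix.mul_smul, Matrix.smul_mul, Submodule.coe_smul,
          RingHom.id_apply]
        module }

lemma coe_spProj (x : Mat m) :
    (spProj m x : Mat m) = (1 / 2 : ℝ) • (x + J (Fin m) ℝ * xᵀ * J (Fin m) ℝ) := rfl

lemma spProj_of_mem {x : Mat m} (hx : x ∈ spTangent m) : (spProj m x : Mat m) = x := by
  rw [coe_spProj, Matrix.mul_assoc, mem_spTangent_iff.1 hx, Matrix.mul_neg, ← Matrix.mul_assoc,
    J_squared, Matrix.neg_mul, Matrix.one_mul, neg_neg]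
  module

lemma norm_transpose_mat (x : Mat m) : ‖xᵀ‖ = ‖x‖ := Matrix.frobenius_norm_transpose x

/-- The Lie algebra is the fixed space of the involution x ↦ J xᵀ J. For X = 1 + x symplectic, the
complementary component x - J xᵀ J equals the quadratic expression J xᵀ J x. Two such x with the
same projection thus differ by a quadratic difference, which a contraction estimate forces to vanish
in a small ball. -/
lemma eq_of_spProj_sub_one_eq {X Y : Mat m} (hX : X ∈ Sp m) (hY : Y ∈ Sp m)
    (h : spProj m (X - 1) = spProj m (Y - 1)) {ρ : ℝ} (hρ : ‖J (Fin m) ℝ‖ ^ 2 * ρ < 1)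
    (hXρ : ‖X - 1‖ ≤ ρ) (hYρ : ‖Y - 1‖ ≤ ρ) : X = Y := by
  have hJ := J_squared (Fin m) ℝ
  have key : ∀ {X : Mat m}, X ∈ Sp m → (X - 1) - J (Fin m) ℝ * (X - 1)ᵀ * J (Fin m) ℝ =
      J (Fin m) ℝ * (X - 1)ᵀ * J (Fin m) ℝ * (X - 1) := fun {X} hX => by
    have h1 := mem_Sp_iff.1 hX
    have h2 : J (Fin m) ℝ * (Xᵀ * J (Fin m) ℝ * X) = -1 := by rw [h1, hJ]
    simp only [Matrix.transpose_sub, Matrix.transpose_one, Matrix.mul_sub, Matrix.sub_mul,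
      Matrix.mul_one, Matrix.mul_assoc, hJ] at h2 ⊢
    rw [h2, Matrix.neg_mul, Matrix.one_mul]
    abel
  set x := X - 1 with hx
  set y := Y - 1 with hy
  have kx := key hX
  have ky := key hY
  rw [← hx] at kx
  rw [← hy] at ky
  have hproj : x + J (Fin m) ℝ * xᵀ * J (Fin m) ℝ = y + J (Fin m) ℝ * yᵀ * J (Fin m) ℝ := by
    have := congrArg Subtype.val h
    rw [coe_spProj, coe_spProj] at this
    exact smul_right_injective _ (by norm_num : (1 / 2 : ℝ) ≠ 0) this
  have hD : (2 : ℝ) • (x - y) = J (Fin m) ℝ * (x - y)ᵀ * J (Fin m) ℝ * x +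
      J (Fin m) ℝ * yᵀ * J (Fin m) ℝ * (x - y) := by
    have e1 : (2 : ℝ) • (x - y) = (x - J (Fin m) ℝ * xᵀ * J (Fin m) ℝ) -
        (y - J (Fin m) ℝ * yᵀ * J (Fin m) ℝ) + ((x + J (Fin m) ℝ * xᵀ * J (Fin m) ℝ) -
        (y + J (Fin m) ℝ * yᵀ * J (Fin m) ℝ)) := by module
    rw [e1, hproj, sub_self, add_zero, kx, ky]
    simp only [Matrix.transpose_sub, Matrix.mul_sub, Matrix.sub_mul]
    abel
  have hle : 2 * ‖x - y‖ ≤ 2 * (‖J (Fin m) ℝ‖ ^ 2 * ρ) * ‖x - y‖ := by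
    calc 2 * ‖x - y‖ = ‖(2 : ℝ) • (x - y)‖ := by rw [norm_smul]; norm_num
      _ ≤ ‖J (Fin m) ℝ‖ * ‖x - y‖ * ‖J (Fin m) ℝ‖ * ‖x‖ +
          ‖J (Fin m) ℝ‖ * ‖y‖ * ‖J (Fin m) ℝ‖ * ‖x - y‖ := by
        rw [hD]
        refine (norm_add_le _ _).trans (add_le_add ?_ ?_)
        · refine (norm_mul_le _ _).trans ?_
          gcongr
          refine (norm_mul_le _ _).trans ?_
          gcongr
          refine (norm_mul_le _ _).trans_eq ?_
          rw [norm_transpose_mat]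
        · refine (norm_mul_le _ _).trans ?_
          gcongr
          refine (norm_mul_le _ _).trans ?_
          gcongr
          refine (norm_mul_le _ _).trans_eq ?_
          rw [norm_transpose_mat]
      _ ≤ ‖J (Fin m) ℝ‖ * ‖x - y‖ * ‖J (Fin m) ℝ‖ * ρ +
          ‖J (Fin m) ℝ‖ * ρ * ‖J (Fin m) ℝ‖ * ‖x - y‖ := by gcongr
      _ = _ := by ring
  have h0 : ‖x - y‖ = 0 := by
    have := norm_nonneg (x - y)
    by_contra hne
    have hpos : 0 < ‖x - y‖ := lt_of_le_of_ne this (Ne.symm hne)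
    nlinarith
  have h1 := sub_eq_zero.1 (norm_eq_zero.1 h0)
  rw [hx, hy] at h1
  exact sub_left_injective h1

end Symplectic

end SympControl

/-! ### Taylor coefficients of the conjugated curves and their algebraic relations. -/

namespace SympControl
open intervalIntegral Filter Topology Matrix

section Brackets
variable {m : ℕ} {T : ℝ}

lemma contDiffOn_bracketSeq (hT : 0 < T) {A : ℝ → Mat m} (hA : ContDiffOn ℝ ∞ A (Icc 0 T))
    (b : Mat m) (j : ℕ) : ContDiffOn ℝ ∞ (bracketSeq T A b j) (Icc 0 T) := by
  induction j with
  | zero => exact contDiffOn_const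
  | succ j ih =>
    exact ((ih.derivWithin (uniqueDiffOn_Icc hT) (by simp)).add (ih.mul hA)).sub (hA.mul ih)

/-- Bootstrap: the derivative A S is as regular as S. -/
lemma contDiffOn_of_hasDerivAt_mul (hT : 0 < T) {A S : ℝ → Mat m}
    (hA : ContDiffOn ℝ ∞ A (Icc 0 T)) (hS : ∀ t ∈ Icc 0 T, HasDerivAt S (A t * S t) t) (n : ℕ) :
    ContDiffOn ℝ n S (Icc 0 T) := by
  induction n with
  | zero => exact contDiffOn_zero.2 fun t ht => (hS t ht).continuousAt.continuousWithinAt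
  | succ n ih =>
    rw [Nat.cast_succ, contDiffOn_succ_iff_derivWithin (uniqueDiffOn_Icc hT)]
    refine ⟨fun t ht => (hS t ht).differentiableAt.differentiableWithinAt, fun h => ?_, ?_⟩
    · simp at h
    · refine ((hA.of_le (by exact_mod_cast le_top)).mul ih).congr fun t ht => ?_
      exact (hS t ht).hasDerivWithinAt.derivWithin (uniqueDiffOn_Icc hT t ht)

/-- The derivative of `S⁻¹ B_i^j S` is `S⁻¹ B_i^{j+1} S`. -/
lemma hasDerivWithinAt_conj_bracketSeq (hT : 0 < T) {A S : ℝ → Mat m}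
    (hA : ContDiffOn ℝ ∞ A (Icc 0 T)) (hAs : ∀ t ∈ Icc 0 T, A t ∈ spTangent m)
    (hS : ∀ t ∈ Icc 0 T, HasDerivAt S (A t * S t) t) (b : Mat m) (j : ℕ) {t : ℝ}
    (ht : t ∈ Icc 0 T) :
    HasDerivWithinAt (fun t => sympInv (S t) * bracketSeq T A b j t * S t)
      (sympInv (S t) * bracketSeq T A b (j + 1) t * S t) (Icc 0 T) t := by
  have h1 := (hasDerivAt_sympInv (hS t ht) (hAs t ht)).hasDerivWithinAt (s := Icc 0 T)
  have h2 : HasDerivWithinAt (bracketSeq T A b j) (derivWithin (bracketSeq T A b j) (Icc 0 T) t)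
      (Icc 0 T) t :=
    ((contDiffOn_bracketSeq hT hA b j).differentiableOn (by simp) t ht).hasDerivWithinAt
  refine ((h1.mul h2).mul (hS t ht).hasDerivWithinAt).congr_deriv ?_
  simp only [bracketSeq, Pi.mul_apply]
  noncomm_ring

lemma iteratedDerivWithin_conj (hT : 0 < T) {A S : ℝ → Mat m}
    (hA : ContDiffOn ℝ ∞ A (Icc 0 T)) (hAs : ∀ t ∈ Icc 0 T, A t ∈ spTangent m)
    (hS : ∀ t ∈ Icc 0 T, HasDerivAt S (A t * S t) t) (b : Mat m) (j : ℕ) {t : ℝ}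
    (ht : t ∈ Icc 0 T) :
    iteratedDerivWithin j (fun t => sympInv (S t) * b * S t) (Icc 0 T) t =
      sympInv (S t) * bracketSeq T A b j t * S t := by
  induction j generalizing t with
  | zero => rfl
  | succ j ih =>
    rw [iteratedDerivWithin_succ, derivWithin_congr (fun s hs => ih hs) (ih ht)]
    exact (hasDerivWithinAt_conj_bracketSeq hT hA hAs hS b j ht).derivWithin
      (uniqueDiffOn_Icc hT t ht)

lemma exists_taylor_conj (hT : 0 < T) {A S : ℝ → Mat m}
    (hA : ContDiffOn ℝ ∞ A (Icc 0 T)) (hAs : ∀ t ∈ Icc 0 T, A t ∈ spTangent m)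
    (hS : ∀ t ∈ Icc 0 T, HasDerivAt S (A t * S t) t) (hS0 : S 0 = 1) (b : Mat m) (n : ℕ) :
    ∃ K, ∀ x ∈ Icc 0 T, ‖sympInv (S x) * b * S x -
      ∑ j ∈ Finset.range (n + 1), x ^ j • ((j.factorial : ℝ)⁻¹ • bracketSeq T A b j 0)‖ ≤
        K * x ^ (n + 1) := by
  have h0 : (0 : ℝ) ∈ Icc 0 T := ⟨le_rfl, hT.le⟩
  have hSc : ContDiffOn ℝ ((n + 1 : ℕ) : ℕ∞ω) S (Icc 0 T) :=
    contDiffOn_of_hasDerivAt_mul hT hA hS _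
  have hR : ContDiffOn ℝ ((n + 1 : ℕ) : ℕ∞ω) (fun t => sympInv (S t)) (Icc 0 T) := by
    have ht : ContDiffOn ℝ ((n + 1 : ℕ) : ℕ∞ω) (fun t => (S t)ᵀ) (Icc 0 T) :=
      (LinearMap.toContinuousLinearMap (Matrix.transposeLinearEquiv
        (Fin m ⊕ Fin m) (Fin m ⊕ Fin m) ℝ ℝ).toLinearMap).contDiff.comp_contDiffOn hSc
    exact ((contDiffOn_const.mul ht).mul contDiffOn_const).neg
  obtain ⟨K, hK⟩ := exists_taylor_mean_remainder_bound (n := n) hT.le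
    (f := fun t => sympInv (S t) * b * S t) (by exact_mod_cast (hR.mul contDiffOn_const).mul hSc)
  have h1 : sympInv (1 : Mat m) = 1 := by
    have := sympInv_mul (one_mem_Sp (m := m))
    rwa [mul_one] at this
  have hterm : ∀ (x : ℝ) (j : ℕ), ((j.factorial : ℝ)⁻¹ * x ^ j) •
      iteratedDerivWithin j (fun t => sympInv (S t) * b * S t) (Icc 0 T) 0 =
      x ^ j • ((j.factorial : ℝ)⁻¹ • bracketSeq T A b j 0) := fun x j => by
    rw [iteratedDerivWithin_conj hT hA hAs hS b j h0, hS0, h1, one_mul, mul_one, smul_smul, mul_comm]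
  refine ⟨K, fun x hx => ?_⟩
  have := hK x hx
  rwa [taylor_within_apply, sub_zero, Finset.sum_congr rfl fun j _ => hterm x j] at this

lemma bracketSeq_one (A : ℝ → Mat m) (b : Mat m) (t : ℝ) :
    bracketSeq T A b 1 t = b * A t - A t * b := by
  change derivWithin (fun _ => b) (Icc 0 T) t + b * A t - A t * b = _
  have h : derivWithin (fun _ : ℝ => b) (Icc 0 T) t = 0 :=
    congrFun (derivWithin_fun_const (Icc 0 T) b) t
  rw [h, zero_add]

lemma bracketSeq_two (hT : 0 < T) {A : ℝ → Mat m} (hA : ContDiffOn ℝ ∞ A (Icc 0 T)) (b : Mat m)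
    {t : ℝ} (ht : t ∈ Icc 0 T) :
    bracketSeq T A b 2 t = b * derivWithin A (Icc 0 T) t - derivWithin A (Icc 0 T) t * b +
      (b * A t - A t * b) * A t - A t * (b * A t - A t * b) := by
  have hd : HasDerivWithinAt A (derivWithin A (Icc 0 T) t) (Icc 0 T) t :=
    (hA.differentiableOn (by simp) t ht).hasDerivWithinAt
  have h1 : bracketSeq T A b 1 = fun t => b * A t - A t * b := funext (bracketSeq_one A b)
  change derivWithin (bracketSeq T A b 1) (Icc 0 T) t + bracketSeq T A b 1 t * A t -
    A t * bracketSeq T A b 1 t = _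
  have h2 : HasDerivWithinAt (fun t => b * A t - A t * b) _ (Icc 0 T) t :=
    (hd.const_mul b).sub (hd.mul_const b)
  have h3 : derivWithin (fun t => b * A t - A t * b) (Icc 0 T) t = _ :=
    h2.derivWithin (uniqueDiffOn_Icc hT t ht)
  rw [h1, h3]

/-- This relation and `bracketSeq_two_mul_add` are, up to conjugation by S, the first and second
derivatives of (S⁻¹ b S)(S⁻¹ b' S) = 0, checked here as polynomial identities in A and its
derivative. -/
lemma bracketSeq_one_mul_add (A : ℝ → Mat m) {b b' : Mat m} (h : b * b' = 0) (t : ℝ) :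
    bracketSeq T A b 1 t * b' + b * bracketSeq T A b' 1 t = 0 := by
  have e : ∀ x y : Mat m, (b * x - x * b) * b' + b * (b' * x - x * b') =
      (b * b') * x - x * (b * b') := fun x _ => by noncomm_ring
  rw [bracketSeq_one, bracketSeq_one, e _ 0, h, zero_mul, mul_zero, sub_zero]

lemma bracketSeq_two_mul_add (hT : 0 < T) {A : ℝ → Mat m} (hA : ContDiffOn ℝ ∞ A (Icc 0 T))
    {b b' : Mat m} (h : b * b' = 0) {t : ℝ} (ht : t ∈ Icc 0 T) :
    bracketSeq T A b 2 t * b' + (2 : ℝ) • (bracketSeq T A b 1 t * bracketSeq T A b' 1 t) +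
      b * bracketSeq T A b' 2 t = 0 := by
  rw [bracketSeq_two hT hA b ht, bracketSeq_two hT hA b' ht, bracketSeq_one, bracketSeq_one]
  generalize derivWithin A (Icc 0 T) t = y
  generalize A t = x
  have e : (b * y - y * b + (b * x - x * b) * x - x * (b * x - x * b)) * b' +
      (2 : ℝ) • ((b * x - x * b) * (b' * x - x * b')) +
      b * (b' * y - y * b' + (b' * x - x * b') * x - x * (b' * x - x * b')) =
      (b * b') * y - y * (b * b') + (b * b') * x * x + x * x * (b * b') -
        (2 : ℝ) • (x * (b * b') * x) := by
    rw [two_smul, two_smul]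
    noncomm_ring
  rw [e, h]
  simp

end Brackets

/-! ### From continuous controls to L² controls, and variation of constants. -/

section Controls
variable {T : ℝ} {k : ℕ}

lemma exists_control (hT : 0 ≤ T) : ∃ c > 0, ∀ u : Fin k → C(Icc (0 : ℝ) T, ℝ),
    ∃ v : Control k T, ‖v‖ ≤ c * ‖u‖ ∧
      ∀ᵐ t ∂(volume.restrict (Icc (0 : ℝ) T)), ∀ i, v t i = extend hT (u i) t := by
  let E : (Fin k → ℝ) →L[ℝ] EuclideanSpace ℝ (Fin k) :=
    ((PiLp.continuousLinearEquiv 2 ℝ (fun _ : Fin k => ℝ)).symm : _ →L[ℝ] _)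
  set c := (measureUnivNNReal (volume.restrict (Icc (0 : ℝ) T)) : ℝ) ^ (2 : ENNReal).toReal⁻¹ * ‖E‖
  have hc : 0 ≤ c := by positivity
  refine ⟨c + 1, by positivity, fun u => ?_⟩
  let g : ℝ → EuclideanSpace ℝ (Fin k) := fun t => E fun i => extend hT (u i) t
  have hg : Continuous g := E.continuous.comp
    (continuous_pi fun i => continuous_extend hT (u i))
  have hle : ∀ t, ‖g t‖ ≤ ‖E‖ * ‖u‖ := fun t => by
    refine (E.le_opNorm _).trans (mul_le_mul_of_nonneg_left ?_ (norm_nonneg _))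
    exact (pi_norm_le_iff_of_nonneg (norm_nonneg _)).2 fun i =>
      (norm_extend_le hT (u i) t).trans (norm_le_pi_norm u i)
  have hmem : MemLp g 2 (volume.restrict (Icc (0 : ℝ) T)) :=
    MemLp.of_bound hg.aestronglyMeasurable _ (.of_forall hle)
  refine ⟨hmem.toLp g, ?_, ?_⟩
  · refine (Lp.norm_le_of_ae_bound (C := ‖E‖ * ‖u‖) (by positivity) ?_).trans ?_
    · filter_upwards [hmem.coeFn_toLp] with t ht
      rw [ht]
      exact hle t
    · rw [← mul_assoc]
      exact mul_le_mul_of_nonneg_right (by linarith) (norm_nonneg _)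
  · filter_upwards [hmem.coeFn_toLp] with t ht i
    rw [ht]
    rfl

/-- Variation of constants: S carries the drift, and the control terms become B_i because S S⁻¹ B_i
S W = B_i S W. -/
lemma isSolution_mul {m : ℕ} (hT : 0 ≤ T) {A S W : ℝ → Mat m} {B : Fin k → Mat m}
    {X₀ : Mat m} (hA : ContinuousOn A (Icc 0 T)) (hS0 : S 0 = 1)
    (hS : ∀ t ∈ Icc 0 T, HasDerivAt S (A t * S t) t) (hSp : ∀ t ∈ Icc 0 T, S t ∈ Sp m)
    {u : Fin k → C(Icc (0 : ℝ) T, ℝ)} {v : Control k T}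
    (hv : ∀ᵐ t ∂(volume.restrict (Icc (0 : ℝ) T)), ∀ i, v t i = extend hT (u i) t)
    (hW0 : W 0 = 1) (hW : ∀ t ∈ Icc 0 T, HasDerivAt W
      ((∑ i, extend hT (u i) t • (sympInv (S t) * B i * S t)) * W t) t) :
    IsSolution T A B v X₀ fun t => S t * W t * X₀ := by
  have hd : ∀ t ∈ Icc 0 T, HasDerivAt (fun t => S t * W t * X₀) (A t * (S t * W t * X₀) +
      ∑ i, extend hT (u i) t • (B i * (S t * W t * X₀))) t := fun t ht => by
    refine (((hS t ht).mul (hW t ht)).mul_const X₀).congr_deriv ?_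
    simp only [add_mul, Finset.sum_mul, Finset.mul_sum, smul_mul_assoc, mul_smul_comm]
    congr 1
    · simp only [mul_assoc]
    · refine Finset.sum_congr rfl fun i _ => ?_
      congr 1
      have : S t * (sympInv (S t) * B i * S t * W t) * X₀ =
          (S t * sympInv (S t)) * (B i * (S t * W t * X₀)) := by simp only [mul_assoc]
      rw [this, mul_sympInv (hSp t ht), one_mul]
  have hZ : ContinuousOn (fun t => S t * W t * X₀) (Icc 0 T) := fun t ht =>
    (hd t ht).continuousAt.continuousWithinAt
  refine ⟨absolutelyContinuous_of_hasDerivAt hT hd ?_, by simp [hS0, hW0], ?_⟩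
  · refine (hA.mul hZ).add (continuousOn_finsetSum _ fun i _ => ?_)
    exact (continuous_extend hT (u i)).continuousOn.smul (continuousOn_const.mul hZ)
  · filter_upwards [hv, ae_restrict_mem measurableSet_Icc] with t hvt ht
    have := hd t ht
    simp only [← hvt] at this
    exact this

end Controls

end SympControl

/-! ### Range of the linearized end-point map and second order surjectivity. -/

namespace SympControl
open intervalIntegral Filter Topology Matrix

/-- Continuous curves on `[0,T]`, for the topology of the norm. -/
abbrev NormedCurve (T : ℝ) (E : Type*) [NormedAddCommGroup E] : Type _ := C(Icc (0 : ℝ) T, E)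

/-- A functional vanishing on the range of the linearized end-point map vanishes on the curves
`C i`. -/
lemma apply_eq_zero_of_endValue_eq_zero {𝔸 : Type*} [NormedRing 𝔸] [NormedAlgebra ℝ 𝔸]
    [CompleteSpace 𝔸] {T : ℝ} {k : ℕ} (hT : 0 < T) {C : Fin k → C(Icc (0 : ℝ) T, 𝔸)}
    {θ : 𝔸 →L[ℝ] ℝ} (hθ : ∀ u, endValue hT.le θ (controlOp hT.le C u 1) = 0) (i : Fin k)
    (t : Icc (0 : ℝ) T) : θ (C i t) = 0 := by
  -- Testing with the control u_i = θ ∘ C_i turns the linear term into the integral of the square of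
  -- θ ∘ C_i.
  let u : Fin k → C(Icc (0 : ℝ) T, ℝ) := Pi.single i ⟨fun t => θ (C i t), by fun_prop⟩
  have hc := continuous_extend hT.le (C i)
  have h1 : ∫ s in (0 : ℝ)..T, θ (extend hT.le (C i) s) ^ 2 = 0 := by
    refine Eq.trans ?_ (hθ u)
    change _ = θ (volterra hT.le (controlCurve C u) 1 _)
    rw [volterra_one_apply,
      ← θ.intervalIntegral_comp_comm ((continuous_extend _ _).intervalIntegrable _ _)]
    refine integral_congr fun s hs => ?_
    rw [uIcc_of_le hT.le] at hs
    rw [extend_of_mem _ _ hs, extend_of_mem _ _ hs, controlCurve_apply,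
      Finset.sum_eq_single i (fun j _ hj => by simp [u, Pi.single_eq_of_ne hj])
      (fun h => absurd (Finset.mem_univ i) h)]
    simp [u, pow_two]
  by_contra h
  refine (integral_pos hT (f := fun s => θ (extend hT.le (C i) s) ^ 2)
    (Continuous.continuousOn (by fun_prop)) (fun s _ => sq_nonneg _) ⟨t, t.2, ?_⟩).ne' h1
  rw [extend_of_mem _ _ t.2]
  positivity

/-- Second order local surjectivity of the end-point map of `W' = (∑ i, u i • C i) W`. -/
lemma exists_second_order_control {𝔸 G : Type*} [NormedRing 𝔸] [NormedAlgebra ℝ 𝔸]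
    [CompleteSpace 𝔸] [NormedAddCommGroup G] [NormedSpace ℝ G] [FiniteDimensional ℝ G] {T : ℝ}
    {k : ℕ} (hT : 0 < T) (C : Fin k → NormedCurve T 𝔸)
    (L : 𝔸 →L[ℝ] G) {a : Fin k → ℕ → 𝔸} {K : ℝ}
    (ha3 : ∀ i, ∀ x ∈ Icc 0 T,
      ‖extend hT.le (C i) x - ∑ j ∈ Finset.range 3, x ^ j • a i j‖ ≤ K * x ^ 3)
    (ha4 : ∀ i, ∀ x ∈ Icc 0 T,
      ‖extend hT.le (C i) x - ∑ j ∈ Finset.range 4, x ^ j • a i j‖ ≤ K * x ^ 4)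
    (h0 : ∀ i j, a i 0 * a j 0 = 0) (h1 : ∀ i j, a i 1 * a j 0 + a i 0 * a j 1 = 0)
    (h2 : ∀ i j, a i 2 * a j 0 + a i 1 * a j 1 + a i 0 * a j 2 = 0)
    {V : Submodule ℝ G}
    (hV : ∀ y, y ∈ V ↔ ∃ u, endValue hT.le L (controlOp hT.le C u 1) = y)
    (hV1 : ∀ i, L (a i 1 * a i 0 - a i 0 * a i 1) ∈ V)
    (hV2 : ∀ i, L (a i 2 * a i 0 - a i 0 * a i 2) ∈ V)
    (hspan : V ⊔ Submodule.span ℝ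
      (range fun p : Fin k × Fin k => L (a p.1 1 * a p.2 1 - a p.2 1 * a p.1 1)) = ⊤)
    {ρ : ℝ} (hρ : 0 < ρ) :
    ∃ r > 0, ∃ c > 0, ∀ ε : ℝ, |ε| < r → ∀ y, ‖y‖ < r →
      ∃ (u : Fin k → C(Icc (0 : ℝ) T, ℝ)) (W : NormedCurve T 𝔸), ‖u‖ ≤ c * |ε| ∧
        W = 1 + volterra hT.le (controlCurve C u) W ∧ ‖W - 1‖ < ρ ∧
        L (W ⟨T, hT.le, le_rfl⟩) = L 1 + ε ^ 2 • y := by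
  have : CompleteSpace G := FiniteDimensional.complete ℝ G
  obtain ⟨w, z₀, hw, hz₀, hsurj⟩ := exists_regular_control hT C L ha3 ha4 h0 h1 h2 hV hV1 hV2 hspan
  exact exists_second_order_preimage (controlOp hT.le C) 1 (endValue hT.le L) hw hz₀ hsurj hρ

/-- All the matrices `B_i^j(0)` lie in the range of the linearized end-point map. -/
lemma apply_bracketSeq_eq_zero {m : ℕ} {T : ℝ} (hT : 0 < T) {A S : ℝ → Mat m}
    (hA : ContDiffOn ℝ ∞ A (Icc 0 T)) (hAs : ∀ t ∈ Icc 0 T, A t ∈ spTangent m)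
    (hS : ∀ t ∈ Icc 0 T, HasDerivAt S (A t * S t) t) {b : Mat m} {θ : Mat m →L[ℝ] ℝ}
    (hθ : ∀ t ∈ Icc 0 T, θ (sympInv (S t) * b * S t) = 0) (j : ℕ) :
    ∀ t ∈ Icc 0 T, θ (sympInv (S t) * bracketSeq T A b j t * S t) = 0 := by
  induction j with
  | zero => exact hθ
  | succ j ih =>
    intro t ht
    have h1 := θ.hasFDerivAt.comp_hasDerivWithinAt t
      (hasDerivWithinAt_conj_bracketSeq hT hA hAs hS b j ht)
    have h2 : HasDerivWithinAt (fun _ : ℝ => (0 : ℝ)) 0 (Icc 0 T) t :=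
      hasDerivWithinAt_const _ _ _
    exact (uniqueDiffOn_Icc hT t ht).eq_deriv _ h1 (h2.congr ih (ih t ht))

lemma exists_forall_norm_le {F G : Type*} [NormedAddCommGroup F] [NormedSpace ℝ F]
    [NormedAddCommGroup G] [NormedSpace ℝ G] (L : F →L[ℝ] G) :
    ∃ c, 0 ≤ c ∧ ∀ x, ‖L x‖ ≤ c * ‖x‖ :=
  ⟨‖L‖, norm_nonneg _, L.le_opNorm⟩

end SympControl

/-! ### Assembly: second order controllability in Sp(m). -/

open SympControl in
theorem proposition2 {m k : ℕ} (T : ℝ) (hT : 0 < T)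
    (A : ℝ → SympControl.Mat m) (B : Fin k → SympControl.Mat m)
    (hA_smooth : ContDiffOn ℝ ∞ A (Icc 0 T))
    (hA : ∀ t ∈ Icc 0 T, A t ∈ SympControl.spTangent m)
    (hB : ∀ i, B i ∈ SympControl.spTangent m)
    (hBB : ∀ i j, B i * B j = 0)
    (hbracket : ∀ i, ∀ j ∈ ({1, 2} : Set ℕ),
      ⁅SympControl.bracketSeq T A (B i) j 0, B i⁆ ∈
        Submodule.span ℝ {Y | ∃ (r : Fin k) (s : ℕ), Y = SympControl.bracketSeq T A (B r) s 0})
    (hspan : Submodule.span ℝ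
        ({Y | ∃ (i : Fin k) (j : ℕ), j ≤ 2 ∧ Y = SympControl.bracketSeq T A (B i) j 0} ∪
          {Y | ∃ i l : Fin k, Y = ⁅SympControl.bracketSeq T A (B i) 1 0,
            SympControl.bracketSeq T A (B l) 1 0⁆}) = SympControl.spTangent m)
    (X₀ : SympControl.Mat m) (hX₀ : X₀ ∈ SympControl.Sp m) :
    SympControl.ControllableAtSecondOrder T A B 0 X₀ := by
  have h0T : (0 : ℝ) ∈ Icc 0 T := ⟨le_rfl, hT.le⟩
  have hTT : T ∈ Icc 0 T := ⟨hT.le, le_rfl⟩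
  have : CompleteSpace (Mat m) := FiniteDimensional.complete ℝ _
  -- the fundamental solution of the drift
  obtain ⟨S, hS0, hS⟩ := exists_linear_ode hT.le hA_smooth.continuousOn
  have hSp : ∀ t ∈ Icc 0 T, S t ∈ Sp m := fun t ht =>
    mem_Sp_of_hasDerivAt hS hA (by rw [hS0]; exact one_mem_Sp) ht
  have hSinv1 : sympInv (1 : Mat m) = 1 := by
    have := sympInv_mul (one_mem_Sp (m := m))
    rwa [mul_one] at this
  have hCc : ∀ i, ContinuousOn (fun t => sympInv (S t) * B i * S t) (Icc 0 T) := fun i t ht =>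
    (((hasDerivAt_sympInv (hS t ht) (hA t ht)).continuousAt.mul
      continuousAt_const).mul (hS t ht).continuousAt).continuousWithinAt
  let C : Fin k → NormedCurve T (Mat m) := fun i => ⟨_, (hCc i).domRestrict⟩
  have hCapp : ∀ i, ∀ t (ht : t ∈ Icc 0 T), C i ⟨t, ht⟩ = sympInv (S t) * B i * S t :=
    fun i t ht => rfl
  -- Taylor expansions at the initial time
  let a : Fin k → ℕ → Mat m := fun i j => (j.factorial : ℝ)⁻¹ • bracketSeq T A (B i) j 0
  have ha0 : ∀ i, a i 0 = B i := fun i => by simp [a, bracketSeq]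
  have ha1 : ∀ i, a i 1 = bracketSeq T A (B i) 1 0 := fun i => by simp [a]
  have ha2 : ∀ i, a i 2 = (1 / 2 : ℝ) • bracketSeq T A (B i) 2 0 := fun i => by
    simp [a, Nat.factorial]
  choose K₃ hK₃ using fun i => exists_taylor_conj hT hA_smooth hA hS hS0 (B i) 2
  choose K₄ hK₄ using fun i => exists_taylor_conj hT hA_smooth hA hS hS0 (B i) 3
  let K := ∑ i, (|K₃ i| + |K₄ i|)
  have hle : ∀ i, |K₃ i| + |K₄ i| ≤ K := fun i =>
    Finset.single_le_sum (f := fun i => |K₃ i| + |K₄ i|) (fun j _ => by positivity)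
      (Finset.mem_univ i)
  have hT3 : ∀ i, ∀ x ∈ Icc 0 T,
      ‖extend hT.le (C i) x - ∑ j ∈ Finset.range 3, x ^ j • a i j‖ ≤ K * x ^ 3 := by
    intro i x hx
    rw [extend_of_mem _ _ hx, hCapp]
    refine (hK₃ i x hx).trans (mul_le_mul_of_nonneg_right ?_ (pow_nonneg hx.1 _))
    linarith [hle i, le_abs_self (K₃ i), abs_nonneg (K₄ i)]
  have hT4 : ∀ i, ∀ x ∈ Icc 0 T,
      ‖extend hT.le (C i) x - ∑ j ∈ Finset.range 4, x ^ j • a i j‖ ≤ K * x ^ 4 := by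
    intro i x hx
    rw [extend_of_mem _ _ hx, hCapp]
    refine (hK₄ i x hx).trans (mul_le_mul_of_nonneg_right ?_ (pow_nonneg hx.1 _))
    linarith [hle i, le_abs_self (K₄ i), abs_nonneg (K₃ i)]
  have h0 : ∀ i j, a i 0 * a j 0 = 0 := fun i j => by rw [ha0, ha0, hBB]
  have h1 : ∀ i j, a i 1 * a j 0 + a i 0 * a j 1 = 0 := fun i j => by
    rw [ha0, ha0, ha1, ha1, bracketSeq_one_mul_add A (hBB i j)]
  have h2 : ∀ i j, a i 2 * a j 0 + a i 1 * a j 1 + a i 0 * a j 2 = 0 := fun i j => by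
    have := congrArg (fun x => (1 / 2 : ℝ) • x)
      (bracketSeq_two_mul_add hT hA_smooth (hBB i j) h0T)
    simp only [smul_add, smul_zero, smul_smul] at this
    rw [ha0, ha0, ha1, ha1, ha2, ha2, smul_mul_assoc, mul_smul_comm, ← this]
    norm_num
  -- the range of the linearized end-point map
  let L := spProj m
  let V : Submodule ℝ (spTangent m) := LinearMap.range
    ((endValue hT.le L).comp ((controlOp hT.le C).flip 1)).toLinearMap
  have hV : ∀ y, y ∈ V ↔ ∃ u, endValue hT.le L (controlOp hT.le C u 1) = y := fun y => Iff.rfl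
  -- V is the common kernel of the coordinates of π, so it suffices to treat one functional
  -- vanishing on V at a time.
  have hVB : ∀ r s, L (bracketSeq T A (B r) s 0) ∈ V := by
    intro r s
    obtain ⟨d, π, -, hker⟩ := exists_surjective_ker_eq V
    rw [← hker]
    funext j
    let θ : Mat m →L[ℝ] ℝ := (ContinuousLinearMap.proj j).comp (π.comp L)
    have hθ : ∀ u, endValue hT.le θ (controlOp hT.le C u 1) = 0 := fun u =>
      congrFun ((hker _).2 ((hV _).2 ⟨u, rfl⟩)) j
    have := apply_bracketSeq_eq_zero hT hA_smooth hA hS (θ := θ) (b := B r)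
      (fun t ht => apply_eq_zero_of_endValue_eq_zero hT hθ r ⟨t, ht⟩) s 0 h0T
    rw [hS0, hSinv1, one_mul, mul_one] at this
    exact this
  have hVspan : ∀ Y ∈ Submodule.span ℝ
      {Y | ∃ (r : Fin k) (s : ℕ), Y = bracketSeq T A (B r) s 0}, L Y ∈ V := by
    intro Y hY
    refine (Submodule.span_le (p := V.comap (L : Mat m →ₗ[ℝ] spTangent m))).2 ?_ hY
    rintro _ ⟨r, s, rfl⟩
    exact hVB r s
  have hV1 : ∀ i, L (a i 1 * a i 0 - a i 0 * a i 1) ∈ V := fun i => by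
    rw [ha0, ha1, ← Ring.lie_def]
    exact hVspan _ (hbracket i 1 (by simp))
  have hV2 : ∀ i, L (a i 2 * a i 0 - a i 0 * a i 2) ∈ V := fun i => by
    rw [ha0, ha2, smul_mul_assoc, mul_smul_comm, ← smul_sub, ← Ring.lie_def, map_smul]
    exact V.smul_mem _ (hVspan _ (hbracket i 2 (by simp)))
  have hVtop : V ⊔ Submodule.span ℝ
      (range fun p : Fin k × Fin k => L (a p.1 1 * a p.2 1 - a p.2 1 * a p.1 1)) = ⊤ := by
    rw [eq_top_iff]
    rintro y -
    have hy := hspan.ge y.2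
    have hLy : L (y : Mat m) = y := Subtype.ext (spProj_of_mem y.2)
    rw [← hLy]
    refine (Submodule.span_le (p := Submodule.comap (L : Mat m →ₗ[ℝ] spTangent m) (V ⊔ _))).2
      ?_ hy
    rintro Y (⟨i, j, -, rfl⟩ | ⟨i, l, rfl⟩)
    · exact Submodule.mem_sup_left (hVB i j)
    · refine Submodule.mem_sup_right (Submodule.subset_span ⟨(i, l), ?_⟩)
      beta_reduce
      rw [ha1, ha1, Ring.lie_def]
      rfl
  set nJ := ‖Matrix.J (Fin m) ℝ‖ ^ 2
  have hnJ : 0 ≤ nJ := by positivity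
  set ρ := 1 / (nJ + 1)
  have hρ : 0 < ρ := by positivity
  have hρ1 : nJ * ρ < 1 := by
    rw [mul_one_div, div_lt_one (by positivity)]
    linarith
  obtain ⟨r, hr, c₁, hc₁, hmain⟩ := exists_second_order_control hT C L hT3 hT4 h0 h1 h2 hV hV1 hV2
    hVtop hρ
  obtain ⟨c₂, hc₂, hcontrol⟩ := exists_control (k := k) hT.le
  refine ⟨fun t => S t * 1 * X₀, ?_, ?_⟩
  · refine isSolution_mul hT.le (u := 0) (W := fun _ => 1) hA_smooth.continuousOn hS0 hS hSp
      ?_ rfl fun t ht => ?_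
    · filter_upwards [Lp.coeFn_zero (EuclideanSpace ℝ (Fin k)) 2
        (volume.restrict (Icc (0 : ℝ) T))] with t ht i
      rw [ht]
      rfl
    · have : ∑ i : Fin k, extend hT.le ((0 : Fin k → C(Icc (0 : ℝ) T, ℝ)) i) t •
          (sympInv (S t) * B i * S t) = 0 := Finset.sum_eq_zero fun i _ => by
        rw [extend_of_mem _ _ ht]
        simp
      rw [this, zero_mul]
      exact hasDerivAt_const _ _
  set c₃ := ‖sympInv (S T)‖ * ‖sympInv X₀‖
  have hc₃ : 0 ≤ c₃ := by positivity
  obtain ⟨c₄, hc₄, hLle⟩ := exists_forall_norm_le L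
  -- With ε = κ √δ, the target L (Y - 1) / ε² has norm at most c₄ c₃ / κ², which this choice makes
  -- smaller than r.
  set κ := Real.sqrt (c₄ * c₃ / r + 1)
  have hκ2 : κ ^ 2 = c₄ * c₃ / r + 1 := Real.sq_sqrt (by positivity)
  have hκ : 0 < κ := Real.sqrt_pos.2 (by positivity)
  -- The first bound on δ gives |ε| < r, the second keeps Y in the ball of radius ρ where the
  -- projection is injective.
  refine ⟨min ((r / κ) ^ 2) (ρ / (c₃ + 1)), c₂ * (c₁ * κ), by positivity, by positivity, ?_⟩
  rintro X ⟨hXball, hXSp⟩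
  beta_reduce at hXball ⊢
  rw [mul_one] at hXball ⊢
  rw [Metric.mem_ball, dist_eq_norm, lt_min_iff] at hXball
  set δ := ‖X - S T * X₀‖ with hδ
  have hδ0 : 0 ≤ δ := norm_nonneg _
  -- Y is the end point that W must reach in order that S(T) W(T) X₀ = X.
  set Y := sympInv (S T) * X * sympInv X₀ with hY
  have hYSp : Y ∈ Sp m := mul_mem_Sp (mul_mem_Sp (sympInv_mem_Sp (hSp T hTT)) hXSp)
    (sympInv_mem_Sp hX₀)
  have hY1 : ‖Y - 1‖ ≤ c₃ * δ := by
    have : Y - 1 = sympInv (S T) * (X - S T * X₀) * sympInv X₀ := by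
      rw [mul_sub, sub_mul, ← mul_assoc _ (S T), sympInv_mul (hSp T hTT), one_mul,
        mul_sympInv hX₀]
    rw [this]
    calc _ ≤ ‖sympInv (S T)‖ * ‖X - S T * X₀‖ * ‖sympInv X₀‖ :=
          (norm_mul_le _ _).trans (mul_le_mul_of_nonneg_right (norm_mul_le _ _) (norm_nonneg _))
      _ = _ := by ring
  have hYρ : ‖Y - 1‖ ≤ ρ := by
    have h3 : δ * (c₃ + 1) < ρ := (lt_div_iff₀ (by positivity)).1 hXball.2
    nlinarith
  set ε := κ * Real.sqrt δ with hε
  have hε0 : 0 ≤ ε := by positivity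
  have hε2 : ε ^ 2 = κ ^ 2 * δ := by rw [hε, mul_pow, Real.sq_sqrt hδ0]
  have hεr : |ε| < r := by
    rw [abs_of_nonneg hε0, hε, mul_comm, ← lt_div_iff₀ hκ]
    exact (Real.sqrt_lt' (by positivity)).2 hXball.1
  set y : spTangent m := (ε ^ 2)⁻¹ • L (Y - 1) with hy
  -- When δ = 0 the inverse in y is that of zero, and the identity still holds because Y = 1.
  have hLY : ε ^ 2 • y = L (Y - 1) := by
    by_cases h : ε ^ 2 = 0
    · have hδz : δ = 0 := by
        rw [hε2] at h
        exact (mul_eq_zero.1 h).resolve_left (by positivity)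
      have : Y - 1 = 0 := norm_le_zero_iff.1 (by simpa [hδz] using hY1)
      rw [h, this, zero_smul, map_zero]
    · rw [hy, smul_inv_smul₀ h]
  have hyr : ‖y‖ < r := by
    rcases hδ0.eq_or_lt with h | h
    · have : Y - 1 = 0 := norm_le_zero_iff.1 (by simpa [← h] using hY1)
      rw [hy, this, map_zero, smul_zero, norm_zero]
      exact hr
    · rw [hy, norm_smul, norm_inv, norm_pow, Real.norm_of_nonneg hε0, hε2,
        inv_mul_lt_iff₀ (by positivity), hκ2]
      have h3 : ‖L (Y - 1)‖ ≤ c₄ * (c₃ * δ) :=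
        (hLle _).trans (mul_le_mul_of_nonneg_left hY1 hc₄)
      have h4 : (c₄ * c₃ / r + 1) * δ * r = c₄ * (c₃ * δ) + δ * r := by
        field_simp
      rw [h4]
      have : 0 < δ * r := by positivity
      linarith
  obtain ⟨u, W, hu, hWfix, hWρ, hWL⟩ := hmain ε hεr y hyr
  obtain ⟨W', hW'0, hW'd, hW'⟩ := exists_hasDerivAt_of_fixed hT.le (controlCurve C u) W hWfix
  have hM : ∀ t ∈ Icc 0 T, extend hT.le (controlCurve C u) t =
      ∑ i, extend hT.le (u i) t • (sympInv (S t) * B i * S t) := fun t ht => by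
    rw [extend_of_mem _ _ ht, controlCurve_apply]
    exact Finset.sum_congr rfl fun i _ => by rw [extend_of_mem _ _ ht, hCapp]
  have hWSp : W' T ∈ Sp m := by
    refine mem_Sp_of_hasDerivAt hW'd (fun t ht => ?_) (by rw [hW'0]; exact one_mem_Sp) hTT
    rw [hM t ht]
    exact Submodule.sum_mem _ fun i _ => Submodule.smul_mem _ _ (sympInv_conj_mem (hB i))
  -- Only the projections of W(T) and Y have been matched so far; both matrices are symplectic and
  -- close to 1, so they coincide.
  have hWT : W' T = Y := by
    refine eq_of_spProj_sub_one_eq hWSp hYSp ?_ hρ1 ?_ hYρ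
    · have h3 : L (W' T) = L 1 + ε ^ 2 • y := by rw [hW' T hTT]; exact hWL
      change L (W' T - 1) = L (Y - 1)
      rw [map_sub, h3, hLY, add_sub_cancel_left]
    · rw [hW' T hTT]
      exact ((W - 1).norm_coe_le_norm ⟨T, hTT⟩).trans hWρ.le
  obtain ⟨v, hvn, hv⟩ := hcontrol u
  refine ⟨v, ⟨fun t => S t * W' t * X₀, isSolution_mul hT.le hA_smooth.continuousOn hS0 hS hSp hv
    hW'0 fun t ht => ?_, ?_⟩, ?_⟩
  · rw [← hM t ht]
    exact hW'd t ht
  · have : S T * (sympInv (S T) * X * sympInv X₀) * X₀ =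
        (S T * sympInv (S T)) * X * (sympInv X₀ * X₀) := by simp only [mul_assoc]
    beta_reduce
    rw [hWT, hY, this, mul_sympInv (hSp T hTT), sympInv_mul hX₀, one_mul, mul_one]
  · rw [← Real.sqrt_eq_rpow]
    calc ‖v‖ ≤ c₂ * ‖u‖ := hvn
      _ ≤ c₂ * (c₁ * |ε|) := mul_le_mul_of_nonneg_left hu hc₂.le
      _ = c₂ * (c₁ * κ) * Real.sqrt δ := by rw [abs_of_nonneg hε0, hε]; ring
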